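/- Let $n\ge 1$, let $\mathfrak g=\mathfrak{sl}(n,\mathbb C)$, let $\mathfrak h=\mathfrak t\subset\mathfrak g$ be the Cartan subalgebra of traceless diagonal matrices, let $\mathfrak u^{\pm}$ be the spaces of strictly upper, respectively strictly lower, triangular matrices, and let $\mathfrak q=\mathfrak u^+\oplus\mathfrak u^-$ be the orthogonal complement of $\mathfrak t$ for the Killing form. The spin module is the $\mathfrak t$-module $\mathbf S=\bigwedge\mathfrak u^+$ given by the composition $$\mathfrak t\xrightarrow{\ \mathrm{ad}\ }\mathfrak{so}(\mathfrak q)\subset \mathbf C(\mathfrak q)\xrightarrow{\ \gamma\ }\mathrm{End}(\mathbf S),$$ where $\mathbf C(\mathfrak q)$ is the Clifford algebra of $\mathfrak q$ for the Killing form and $\gamma$ is Clifford multiplication. For $\mu\in\mathfrak t^*$, let $\mathrm{mult}_{\mathbf S}(\mu)$ be the dimension of the $\mu$-weight space of $\mathbf S$. Let $\mathcal P(n)$ be the set of sequences of nonnegative integers $\lambda=(\lambda_1\ge\cdots\ge\lambda_n)$ with $\lambda_1+\cdots+\lambda_n=\binom n2$ and $\lambda_1+\cdots+\lambda_i\le (n-1)+\cdots+(n-i)$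 for all $i\in\{1,\dots,n\}$. For $\lambda\in\mathcal P(n)$ put $\mu[\lambda]=\sum_{i=1}^{n-1}(\lambda_i-\lambda_{i+1})\varpi_i$, where $\varpi_i=\epsilon_1+\cdots+\epsilon_i$ and $\epsilon_k\in\mathfrak t^*$ is the $k$-th diagonal coordinate. A spin tableau of shape $\lambda$ is a filling $\tau$ of the boxes of the Young diagram of $\lambda$ by elements of $\{1,\dots,n-1\}$ such that: for every $i\in\{1,\dots,n-1\}$, exactly $i$ boxes have entry $i$, and all of them lie in the first $i+1$ rows; the rows (from left to right) and the columns (from top to bottom) are nondecreasing; and, on the $i$-th row, the entries $\ge i$ are strictly increasing. Let $\mathcal{ST}(\lambda)$ be the set of spin tableaux of shape $\lambda$. For $\tau\in\mathcal{ST}(\lambda)$ and a number $i$ that occurs in the $j$-th column of $\tau$, let $b_{i,j}$ be the number of boxes of entry $i$ among the first $i$ boxes of the $j$-th column, and let $a_{i,j}$ be the sum of $b_{i,j}$ and of the number of boxes of entry $<i$ in the $j$-th column that have no right neighbor or whose right neighbor has entry $>i$. Put $$N_\tau=\prod_{(i,j)}\binom{a_{i,j}}{b_{i,j}},$$ the product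 over all pairs $(i,j)$ such that $i$ occurs in the $j$-th column of $\tau$ (one factor for the last box of entry $i$ in the $j$-th column). Then, for every $\lambda\in\mathcal P(n)$, $$\mathrm{mult}_{\mathbf S}(\mu[\lambda])=\sum_{\tau\in\mathcal{ST}(\lambda)}N_\tau .$$ -/

import Mathlib

open scoped BigOperators

attribute [local instance 100] LieRing.ofAssociativeRing

namespace SpinModule

/-! ### The Lie algebra `𝔰𝔩(n)`, its Cartan subalgebra `𝔱`, and `𝔮 = 𝔲⁺ ⊕ 𝔲⁻` -/

/-- The complex Lie algebra `𝔤 = 𝔰𝔩(n)` of traceless matrices. -/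
abbrev Sl (n : ℕ) : LieSubalgebra ℂ (Matrix (Fin n) (Fin n) ℂ) :=
  LieAlgebra.SpecialLinear.sl (Fin n) ℂ

/-- The Cartan subalgebra `𝔱` of diagonal matrices in `𝔰𝔩(n)`. -/
def cartan (n : ℕ) : LieSubalgebra ℂ (Sl n) where
  carrier := {H | H.1.IsDiag}
  zero_mem' := by
    intro i j _
    simp
  add_mem' := by
    intro a b ha hb i j hij
    simp [ha hij, hb hij]
  smul_mem' := by
    intro c a ha i j hij
    simp [ha hij]
  lie_mem' := by
    intro a b ha hb i j hij
    have ha' := Matrix.isDiag_iff_diagonal_diag a.1 |>.1 ha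
    have hb' := Matrix.isDiag_iff_diagonal_diag b.1 |>.1 hb
    change (⁅a, b⁆ : Sl n).1 i j = 0
    rw [LieAlgebra.SpecialLinear.sl_bracket, ← ha', ← hb']
    simp [hij]

/-- The orthogonal complement `𝔮` of `𝔱` in `𝔰𝔩(n)` for the Killing form: the matrices with zero
diagonal. -/
def qSpace (n : ℕ) : Submodule ℂ (Sl n) where
  carrier := {X | ∀ i, X.1 i i = 0}
  zero_mem' := by
    intro i
    simp
  add_mem' := by
    intro a b ha hb i
    simp [ha i, hb i]
  smul_mem' := by
    intro c a ha i
    simp [ha i]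

/-- The nilradical `𝔲⁺` of the standard Borel subalgebra: strictly upper triangular matrices. -/
def uPlus (n : ℕ) : Submodule ℂ (Sl n) where
  carrier := {X | ∀ i j, j ≤ i → X.1 i j = 0}
  zero_mem' := by
    intro i j _
    simp
  add_mem' := by
    intro a b ha hb i j hij
    simp [ha i j hij, hb i j hij]
  smul_mem' := by
    intro c a ha i j hij
    simp [ha i j hij]

/-- The projection `𝔮 = 𝔲⁺ ⊕ 𝔲⁻ → 𝔲⁺`. -/
noncomputable def upperPart (n : ℕ) : qSpace n →ₗ[ℂ] uPlus n where
  toFun X := ⟨⟨Matrix.of fun i j => if i < j then X.1.1 i j else 0, by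
      change ∑ i : Fin n, (if i < i then X.1.1 i i else 0) = 0
      simp⟩, by
      intro i j hij
      simp [not_lt.2 hij]⟩
  map_add' X Y := by
    ext i j
    by_cases h : i < j <;> simp [h]
  map_smul' c X := by
    ext i j
    by_cases h : i < j <;> simp [h]

/-- The restriction to `𝔮` of the Killing form `(X, Y) ↦ 2 n tr(X Y)` of `𝔰𝔩(n)`. -/
noncomputable def form (n : ℕ) : LinearMap.BilinForm ℂ (qSpace n) :=
  LinearMap.mk₂ ℂ (fun X Y => 2 * (n : ℂ) * (X.1.1 * Y.1.1).trace)
    (by intro X X' Y; simp [add_mul, mul_add])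
    (by intro c X Y; simp; ring)
    (by intro X Y Y'; simp [mul_add])
    (by intro c X Y; simp; ring)

theorem form_apply (n : ℕ) (X Y : qSpace n) :
    form n X Y = 2 * (n : ℂ) * (X.1.1 * Y.1.1).trace := rfl

theorem form_comm (n : ℕ) (X Y : qSpace n) : form n X Y = form n Y X := by
  rw [form_apply, form_apply, Matrix.trace_mul_comm]

/-- The quadratic form `X ↦ ⟨X, X⟩` on `𝔮`. -/
noncomputable def quad (n : ℕ) : QuadraticForm ℂ (qSpace n) :=
  LinearMap.BilinMap.toQuadraticMap (form n)

theorem quad_polar (n : ℕ) (X Y : qSpace n) :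
    QuadraticMap.polar (quad n) X Y = 2 * form n X Y := by
  rw [quad, LinearMap.BilinMap.polar_toQuadraticMap, form_comm n Y X]
  ring

/-! ### The spin module -/

/-- The underlying space `⋀ 𝔲⁺` of the spin module. -/
abbrev Spinors (n : ℕ) : Type := ExteriorAlgebra ℂ (uPlus n)

/-- The functional `u ↦ 2⟨v, u⟩` on `𝔲⁺`; it only depends on the component of `v` in `𝔲⁻`. -/
noncomputable def pairing (n : ℕ) : qSpace n →ₗ[ℂ] Module.Dual ℂ (uPlus n) :=
  LinearMap.mk₂ ℂ (fun X Y => 2 * (2 * (n : ℂ) * (X.1.1 * Y.1.1).trace))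
    (by intro X X' Y; simp [add_mul, mul_add])
    (by intro c X Y; simp; ring)
    (by intro X Y Y'; simp [mul_add])
    (by intro c X Y; simp; ring)

/-- The action of a vector `v = u + w ∈ 𝔲⁺ ⊕ 𝔲⁻ = 𝔮` on `⋀ 𝔲⁺`: exterior multiplication by `u` plus
contraction with `2⟨w, ·⟩`. -/
noncomputable def vecAct (n : ℕ) : qSpace n →ₗ[ℂ] Module.End ℂ (Spinors n) :=
  (LinearMap.mul ℂ (Spinors n)) ∘ₗ (ExteriorAlgebra.ι ℂ) ∘ₗ upperPart n +
    (CliffordAlgebra.contractLeft (Q := (0 : QuadraticForm ℂ (uPlus n)))) ∘ₗ pairing n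

theorem pairing_upperPart (n : ℕ) (v : qSpace n) : pairing n v (upperPart n v) = quad n v := by
  change 2 * (2 * (n : ℂ) * (v.1.1 * (upperPart n v).1.1).trace)
    = 2 * (n : ℂ) * (v.1.1 * v.1.1).trace
  have h : (v.1.1 * v.1.1).trace = 2 * (v.1.1 * (upperPart n v).1.1).trace := by
    have h1 : v.1.1 = (upperPart n v).1.1 + (v.1.1 - (upperPart n v).1.1) := by abel
    have h2 : (v.1.1 * (v.1.1 - (upperPart n v).1.1)).trace
        = (v.1.1 * (upperPart n v).1.1).trace := by
      simp only [Matrix.trace, Matrix.diag, Matrix.mul_apply]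
      rw [Finset.sum_comm]
      refine Finset.sum_congr rfl fun i _ => Finset.sum_congr rfl fun j _ => ?_
      have e : ∀ a b, (upperPart n v).1.1 a b = if a < b then v.1.1 a b else 0 := fun _ _ => rfl
      rw [Matrix.sub_apply, e, e]
      rcases lt_trichotomy i j with hij | hij | hij
      · simp [hij, not_lt.2 hij.le, mul_comm]
      · subst hij
        simp [v.2 i]
      · simp [hij, not_lt.2 hij.le, mul_comm]
    rw [mul_sub, Matrix.trace_sub] at h2
    linear_combination h2
  rw [h]
  ring

theorem wedge_add_contract_sq {M : Type*} [AddCommGroup M] [Module ℂ M] (u : M)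
    (d : Module.Dual ℂ M) (t : ExteriorAlgebra ℂ M) :
    ExteriorAlgebra.ι ℂ u * (ExteriorAlgebra.ι ℂ u * t +
        CliffordAlgebra.contractLeft (Q := (0 : QuadraticForm ℂ M)) d t) +
      CliffordAlgebra.contractLeft (Q := (0 : QuadraticForm ℂ M)) d (ExteriorAlgebra.ι ℂ u * t +
        CliffordAlgebra.contractLeft (Q := (0 : QuadraticForm ℂ M)) d t) = d u • t := by
  have h1 := CliffordAlgebra.contractLeft_ι_mul (Q := (0 : QuadraticForm ℂ M)) d u t
  have h2 := CliffordAlgebra.contractLeft_contractLeft (Q := (0 : QuadraticForm ℂ M)) d t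
  have h3 : ExteriorAlgebra.ι ℂ u * (ExteriorAlgebra.ι ℂ u * t) = 0 := by
    rw [← mul_assoc, ExteriorAlgebra.ι_sq_zero, zero_mul]
  rw [mul_add, map_add, h2, h3, ExteriorAlgebra.ι, h1]
  abel

theorem vecAct_apply (n : ℕ) (v : qSpace n) (t : Spinors n) :
    vecAct n v t = ExteriorAlgebra.ι ℂ (upperPart n v) * t +
      CliffordAlgebra.contractLeft (Q := (0 : QuadraticForm ℂ (uPlus n))) (pairing n v) t := rfl

theorem vecAct_sq (n : ℕ) (v : qSpace n) :
    vecAct n v * vecAct n v = algebraMap ℂ (Module.End ℂ (Spinors n)) (quad n v) := by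
  refine LinearMap.ext fun s => ?_
  rw [Module.End.mul_apply, vecAct_apply, vecAct_apply, wedge_add_contract_sq, pairing_upperPart,
    Module.algebraMap_end_apply]

/-- Clifford multiplication `γ : C(𝔮) → End(⋀ 𝔲⁺)`. -/
noncomputable def cliffordMult (n : ℕ) :
    CliffordAlgebra (quad n) →ₐ[ℂ] Module.End ℂ (Spinors n) :=
  CliffordAlgebra.lift (quad n) ⟨vecAct n, vecAct_sq n⟩

/-- The index set `{(i, j) : i ≠ j}` of the basis of elementary matrices of `𝔮`. -/
abbrev Idx (n : ℕ) : Type := {p : Fin n × Fin n // p.1 ≠ p.2}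

/-- The elementary matrix `E_{ij} ∈ 𝔮`, for `i ≠ j`. -/
noncomputable def elem {n : ℕ} (p : Idx n) : qSpace n :=
  ⟨LieAlgebra.SpecialLinear.single p.1.1 p.1.2 p.2 1, by
    intro i
    simp only [LieAlgebra.SpecialLinear.val_single, Matrix.single_apply]
    rw [if_neg]
    rintro ⟨h1, h2⟩
    exact p.2 (h1.trans h2.symm)⟩

/-- The basis of `𝔮` dual to `(E_{ij})` for the Killing form: `E_{ij}* = E_{ji} / (2 n)`. -/
noncomputable def elemDual {n : ℕ} (p : Idx n) : qSpace n :=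
  (2 * (n : ℂ))⁻¹ • elem ⟨p.1.swap, fun h => p.2 h.symm⟩

theorem elem_val {n : ℕ} (p : Idx n) (i j : Fin n) :
    (elem p).1.1 i j = if p.1.1 = i ∧ p.1.2 = j then 1 else 0 := by
  simp [elem, Matrix.single_apply]

theorem elemDual_val {n : ℕ} (p : Idx n) (i j : Fin n) :
    (elemDual p).1.1 i j = if p.1.2 = i ∧ p.1.1 = j then (2 * (n : ℂ))⁻¹ else 0 := by
  simp [elemDual, elem, Matrix.single_apply]

theorem natCast_ne_zero_of_idx {n : ℕ} (p : Idx n) : (n : ℂ) ≠ 0 := by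
  have := p.1.1.pos
  exact_mod_cast this.ne'

theorem form_elem {n : ℕ} (p : Idx n) (X : qSpace n) :
    form n (elem p) X = 2 * n * X.1.1 p.1.2 p.1.1 := by
  rw [form_apply]
  have : (elem p).1.1 = Matrix.single p.1.1 p.1.2 1 := rfl
  rw [this, Matrix.trace_single_mul]
  simp

theorem form_elemDual {n : ℕ} (p : Idx n) (X : qSpace n) :
    form n (elemDual p) X = X.1.1 p.1.1 p.1.2 := by
  have hn := natCast_ne_zero_of_idx p
  rw [elemDual, map_smul, LinearMap.smul_apply, form_elem]
  simp only [Prod.fst_swap, Prod.snd_swap, smul_eq_mul]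
  field_simp

/-- A matrix coefficient, as a linear functional on `𝔮`. -/
def entry {n : ℕ} (i j : Fin n) : qSpace n →ₗ[ℂ] ℂ where
  toFun X := X.1.1 i j
  map_add' _ _ := rfl
  map_smul' _ _ := rfl

theorem qSpace_ext {n : ℕ} {X Y : qSpace n} (h : ∀ i j, i ≠ j → entry i j X = entry i j Y) :
    X = Y := by
  refine Subtype.ext (Subtype.ext (Matrix.ext fun i j => ?_))
  by_cases hij : i = j
  · subst hij
    rw [X.2 i, Y.2 i]
  · exact h i j hij

theorem sum_form_elemDual {n : ℕ} (X : qSpace n) :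
    ∑ p : Idx n, form n (elemDual p) X • elem p = X := by
  refine qSpace_ext fun i j h => ?_
  have e : ∀ p : Idx n, entry i j (elem p) = if p.1.1 = i ∧ p.1.2 = j then 1 else 0 :=
    fun p => elem_val p i j
  simp only [map_sum, map_smul, form_elemDual, e, smul_eq_mul]
  rw [Finset.sum_eq_single ⟨(i, j), h⟩]
  · rw [if_pos ⟨rfl, rfl⟩, mul_one]
    rfl
  · intro p _ hp
    rw [if_neg, mul_zero]
    rintro ⟨h1, h2⟩
    exact hp (Subtype.ext (Prod.ext h1 h2))
  · simp

theorem sum_form_elem {n : ℕ} (X : qSpace n) :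
    ∑ p : Idx n, form n (elem p) X • elemDual p = X := by
  refine qSpace_ext fun i j h => ?_
  have e : ∀ p : Idx n, entry i j (elemDual p) =
      if p.1.2 = i ∧ p.1.1 = j then (2 * (n : ℂ))⁻¹ else 0 :=
    fun p => elemDual_val p i j
  simp only [map_sum, map_smul, form_elem, e, smul_eq_mul]
  rw [Finset.sum_eq_single ⟨(j, i), h.symm⟩]
  · have hn := natCast_ne_zero_of_idx ⟨(j, i), h.symm⟩
    rw [if_pos ⟨rfl, rfl⟩]
    change 2 * (n : ℂ) * X.1.1 i j * (2 * (n : ℂ))⁻¹ = X.1.1 i j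
    field_simp
  · intro p _ hp
    rw [if_neg, mul_zero]
    rintro ⟨h1, h2⟩
    exact hp (Subtype.ext (Prod.ext h2 h1))
  · simp

/-- The Lie algebra `𝔰𝔬(𝔮)` of endomorphisms of `𝔮` that are skew for the Killing form. -/
noncomputable abbrev SoQ (n : ℕ) : LieSubalgebra ℂ (Module.End ℂ (qSpace n)) :=
  skewAdjointLieSubalgebra (form n)

theorem soQ_skew {n : ℕ} (A : SoQ n) (X Y : qSpace n) :
    form n (A.1 X) Y = - form n X (A.1 Y) := by
  have h := A.2
  have h' : A.1 ∈ (form n).skewAdjointSubmodule := h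
  rw [LinearMap.mem_skewAdjointSubmodule] at h'
  have := h' X Y
  simpa using this

/-- The linear map underlying `𝔰𝔬(𝔮) ⊂ C(𝔮)`: `A ↦ ¼ ∑ A(e_p) e_p*`. -/
noncomputable def spinEmbLinear (n : ℕ) :
    Module.End ℂ (qSpace n) →ₗ[ℂ] CliffordAlgebra (quad n) where
  toFun A := (4 : ℂ)⁻¹ • ∑ p : Idx n,
    CliffordAlgebra.ι (quad n) (A (elem p)) * CliffordAlgebra.ι (quad n) (elemDual p)
  map_add' A B := by simp [add_mul, Finset.sum_add_distrib]
  map_smul' c A := by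
    simp only [LinearMap.smul_apply, map_smul, smul_mul_assoc, ← Finset.smul_sum]
    rw [smul_comm]
    rfl

/-- The defining property of the inclusion `𝔰𝔬(𝔮) ⊂ C(𝔮)`: the commutator with the image of `A`
acts on `𝔮 ⊂ C(𝔮)` as `A`. -/
theorem spinEmbLinear_comm_ι {n : ℕ} (A : SoQ n) (v : qSpace n) :
    spinEmbLinear n A.1 * CliffordAlgebra.ι (quad n) v -
      CliffordAlgebra.ι (quad n) v * spinEmbLinear n A.1 =
    CliffordAlgebra.ι (quad n) (A.1 v) := by
  have key : ∀ a b : qSpace n,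
      CliffordAlgebra.ι (quad n) a * CliffordAlgebra.ι (quad n) b * CliffordAlgebra.ι (quad n) v -
      CliffordAlgebra.ι (quad n) v * (CliffordAlgebra.ι (quad n) a * CliffordAlgebra.ι (quad n) b) =
      CliffordAlgebra.ι (quad n) ((2 * form n b v) • a - (2 * form n a v) • b) := by
    intro a b
    have h1 := CliffordAlgebra.ι_mul_ι_add_swap (Q := quad n) b v
    have h2 := CliffordAlgebra.ι_mul_ι_add_swap (Q := quad n) a v
    rw [quad_polar] at h1 h2
    rw [map_sub, map_smul, map_smul, Algebra.smul_def, Algebra.smul_def, ← h1, ← h2,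
      h1, Algebra.commutes, ← h1]
    noncomm_ring
  simp only [spinEmbLinear, LinearMap.coe_mk, AddHom.coe_mk, smul_mul_assoc, mul_smul_comm,
    ← smul_sub, Finset.sum_mul, Finset.mul_sum, ← Finset.sum_sub_distrib, key]
  rw [← map_sum, ← map_smul]
  congr 1
  rw [Finset.sum_sub_distrib]
  have e1 : ∑ p : Idx n, (2 * form n (elemDual p) v) • A.1 (elem p) = (2 : ℂ) • A.1 v := by
    conv_rhs => rw [← sum_form_elemDual v]
    simp [Finset.smul_sum, smul_smul]
  have e2 : ∑ p : Idx n, (2 * form n (A.1 (elem p)) v) • elemDual p = -((2 : ℂ) • A.1 v) := by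
    conv_rhs => rw [← sum_form_elem (A.1 v)]
    simp [Finset.smul_sum, smul_smul, soQ_skew]
  rw [e1, e2, sub_neg_eq_add, ← add_smul, smul_smul]
  norm_num

theorem sum_skew {n : ℕ} (A B : SoQ n) :
    ∑ p : Idx n, CliffordAlgebra.ι (quad n) (B.1 (elem p)) *
      CliffordAlgebra.ι (quad n) (A.1 (elemDual p)) =
    - ∑ p : Idx n, CliffordAlgebra.ι (quad n) (B.1 (A.1 (elem p))) *
      CliffordAlgebra.ι (quad n) (elemDual p) := by
  have h1 : ∀ p : Idx n, A.1 (elemDual p) =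
      -∑ q : Idx n, form n (elemDual p) (A.1 (elem q)) • elemDual q := by
    intro p
    conv_lhs => rw [← sum_form_elem (A.1 (elemDual p))]
    rw [← Finset.sum_neg_distrib]
    refine Finset.sum_congr rfl fun q _ => ?_
    rw [form_comm, soQ_skew, neg_smul]
  have h2 : ∀ q : Idx n, B.1 (A.1 (elem q)) =
      ∑ p : Idx n, form n (elemDual p) (A.1 (elem q)) • B.1 (elem p) := by
    intro q
    conv_lhs => rw [← sum_form_elemDual (A.1 (elem q))]
    simp
  simp only [h1, map_neg, map_sum, map_smul, mul_neg, Finset.mul_sum, mul_smul_comm,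
    Finset.sum_neg_distrib]
  rw [Finset.sum_comm]
  congr 1
  refine Finset.sum_congr rfl fun q _ => ?_
  rw [h2 q]
  simp [Finset.sum_mul]

/-- The inclusion of Lie algebras `𝔰𝔬(𝔮) ⊂ C(𝔮)`. -/
noncomputable def spinEmb (n : ℕ) : SoQ n →ₗ⁅ℂ⁆ CliffordAlgebra (quad n) where
  toLinearMap := spinEmbLinear n ∘ₗ (SoQ n).toSubmodule.subtype
  map_lie' := by
    intro A B
    change spinEmbLinear n ⁅A.1, B.1⁆ =
      spinEmbLinear n A.1 * spinEmbLinear n B.1 - spinEmbLinear n B.1 * spinEmbLinear n A.1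
    have key : ∀ a b : qSpace n,
        spinEmbLinear n A.1 * (CliffordAlgebra.ι (quad n) a * CliffordAlgebra.ι (quad n) b) -
        (CliffordAlgebra.ι (quad n) a * CliffordAlgebra.ι (quad n) b) * spinEmbLinear n A.1 =
        CliffordAlgebra.ι (quad n) (A.1 a) * CliffordAlgebra.ι (quad n) b +
        CliffordAlgebra.ι (quad n) a * CliffordAlgebra.ι (quad n) (A.1 b) := by
      intro a b
      rw [← spinEmbLinear_comm_ι A a, ← spinEmbLinear_comm_ι A b]
      noncomm_ring
    have hB : spinEmbLinear n B.1 = (4 : ℂ)⁻¹ • ∑ p : Idx n,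
      CliffordAlgebra.ι (quad n) (B.1 (elem p)) * CliffordAlgebra.ι (quad n) (elemDual p) := rfl
    have hAB : spinEmbLinear n ⁅A.1, B.1⁆ = (4 : ℂ)⁻¹ • ∑ p : Idx n,
      CliffordAlgebra.ι (quad n) (A.1 (B.1 (elem p)) - B.1 (A.1 (elem p))) *
        CliffordAlgebra.ι (quad n) (elemDual p) := rfl
    rw [hB, hAB, mul_smul_comm, smul_mul_assoc, ← smul_sub, Finset.mul_sum, Finset.sum_mul,
      ← Finset.sum_sub_distrib]
    simp only [key]
    rw [Finset.sum_add_distrib, sum_skew]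
    simp only [map_sub, sub_mul, Finset.sum_sub_distrib]
    rw [sub_eq_add_neg]

theorem cartan_apply_ne {n : ℕ} (H : cartan n) {i j : Fin n} (h : i ≠ j) : H.1.1 i j = 0 :=
  H.2 h

theorem cartan_lie_apply {n : ℕ} (H : cartan n) (X : Sl n) (i j : Fin n) :
    (⁅H.1, X⁆ : Sl n).1 i j = (H.1.1 i i - H.1.1 j j) * X.1 i j := by
  have hH := Matrix.isDiag_iff_diagonal_diag H.1.1 |>.1 H.2
  rw [LieAlgebra.SpecialLinear.sl_bracket, ← hH]
  simp
  ring

/-- The adjoint action of `H ∈ 𝔱` on `𝔮`. -/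
noncomputable def adEnd (n : ℕ) (H : cartan n) : Module.End ℂ (qSpace n) where
  toFun X := ⟨⁅H.1, X.1⁆, fun i => by rw [cartan_lie_apply]; simp⟩
  map_add' X Y := by
    apply Subtype.ext
    simp
  map_smul' c X := by
    apply Subtype.ext
    simp

/-- The adjoint representation `ad : 𝔱 → 𝔰𝔬(𝔮)`. -/
noncomputable def adQ (n : ℕ) : cartan n →ₗ⁅ℂ⁆ SoQ n where
  toFun H := ⟨adEnd n H, by
    change adEnd n H ∈ (form n).skewAdjointSubmodule
    rw [LinearMap.mem_skewAdjointSubmodule]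
    intro X Y
    change form n (adEnd n H X) Y = form n X (-(adEnd n H Y))
    rw [map_neg, form_apply, form_apply]
    change 2 * (n : ℂ) * ((H.1.1 * X.1.1 - X.1.1 * H.1.1) * Y.1.1).trace =
      -(2 * (n : ℂ) * (X.1.1 * (H.1.1 * Y.1.1 - Y.1.1 * H.1.1)).trace)
    have h : (H.1.1 * X.1.1 * Y.1.1).trace = (X.1.1 * (Y.1.1 * H.1.1)).trace := by
      rw [mul_assoc, Matrix.trace_mul_comm, mul_assoc]
    rw [sub_mul, mul_sub, Matrix.trace_sub, Matrix.trace_sub, h, mul_assoc X.1.1]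
    ring⟩
  map_add' H K := by
    apply Subtype.ext
    ext1 X
    apply Subtype.ext
    exact add_lie H.1 K.1 X.1
  map_smul' c H := by
    apply Subtype.ext
    ext1 X
    apply Subtype.ext
    exact smul_lie c H.1 X.1
  map_lie' := by
    intro H K
    apply Subtype.ext
    ext1 X
    apply Subtype.ext
    exact lie_lie H.1 K.1 X.1

/-- The spin module for `𝔥 = 𝔱`: the composition `𝔱 → 𝔰𝔬(𝔮) ⊂ C(𝔮) → End(⋀ 𝔲⁺)`. -/
noncomputable def spinRep (n : ℕ) : cartan n →ₗ⁅ℂ⁆ Module.End ℂ (Spinors n) :=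
  (cliffordMult n).toLieHom.comp ((spinEmb n).comp (adQ n))

/-- The weight space of the spin module for a weight `μ ∈ 𝔱*`. -/
noncomputable def spinWeightSpace (n : ℕ) (μ : Module.Dual ℂ (cartan n)) :
    Submodule ℂ (Spinors n) :=
  ⨅ H : cartan n, Module.End.eigenspace (spinRep n H) (μ H)

/-- The multiplicity of `μ ∈ 𝔱*` in the spin module. -/
noncomputable def spinMult (n : ℕ) (μ : Module.Dual ℂ (cartan n)) : ℕ :=
  Module.finrank ℂ (spinWeightSpace n μ)

/-! ### Partitions and weights

Rows, columns and coordinates, numbered from `1` in the usual convention, are numbered from `0`. -/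

/-- The set `𝒫(n)`: partitions of `n(n-1)/2` with at most `n` parts that are dominated by
`(n-1, n-2, …, 1, 0)`. -/
structure IsSpinPartition (n : ℕ) (lam : Fin n → ℕ) : Prop where
  antitone : Antitone lam
  sum_eq : ∑ i, lam i = n.choose 2
  dominated : ∀ i : Fin n, ∑ k ∈ Finset.Iic i, lam k ≤ ∑ k ∈ Finset.Iic i, (n - 1 - (k : ℕ))

/-- The coordinate functional `ε_k` on `𝔱`. -/
def eps {n : ℕ} (k : Fin n) : Module.Dual ℂ (cartan n) where
  toFun H := H.1.1 k k
  map_add' _ _ := rfl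
  map_smul' _ _ := rfl

/-- The fundamental weight `ε_0 + ⋯ + ε_i`. -/
noncomputable def fundWeight {n : ℕ} (i : Fin n) : Module.Dual ℂ (cartan n) :=
  ∑ k ∈ Finset.Iic i, eps k

/-- The weight `μ[λ] = ∑ (λ_i - λ_{i+1}) ϖ_i`. -/
noncomputable def muWeight {n : ℕ} (lam : Fin n → ℕ) : Module.Dual ℂ (cartan n) :=
  ∑ i : Fin (n - 1),
    ((lam ⟨i, by omega⟩ : ℂ) - (lam ⟨i + 1, by omega⟩ : ℂ)) • fundWeight (⟨i, by omega⟩ : Fin n)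

/-! ### Spin tableaux -/

/-- The boxes of the Young diagram with row lengths `lam`: pairs (row, column). -/
abbrev Box {n : ℕ} (lam : Fin n → ℕ) : Type := (r : Fin n) × Fin (lam r)

/-- The condition that a filling `τ` of the Young diagram of `lam ∈ 𝒫(n)` is a spin tableau.
The entries are numbers `< n`; since there are `n(n-1)/2` boxes, the first condition forces all of
them to be in `{1, …, n-1}`. -/
structure IsSpinTableau {n : ℕ} {lam : Fin n → ℕ} (τ : Box lam → Fin n) : Prop where
  /-- every `i ∈ {1, …, n-1}` is the entry of exactly `i` boxes -/
  content : ∀ i : Fin n, 1 ≤ (i : ℕ) → (Finset.univ.filter fun b : Box lam => τ b = i).card = i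
  /-- the boxes of entry `i` are located within the first `i + 1` rows -/
  location : ∀ b : Box lam, (b.1 : ℕ) < (τ b : ℕ) + 1
  /-- rows are nondecreasing -/
  row_mono : ∀ b c : Box lam, b.1 = c.1 → (b.2 : ℕ) < (c.2 : ℕ) → τ b ≤ τ c
  /-- columns are nondecreasing -/
  col_mono : ∀ b c : Box lam, (b.2 : ℕ) = (c.2 : ℕ) → b.1 < c.1 → τ b ≤ τ c
  /-- on the `i`-th row (`i = b.1 + 1`), the entries `≥ i` are increasing -/
  row_strict : ∀ b c : Box lam, b.1 = c.1 → (b.2 : ℕ) < (c.2 : ℕ) →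
    (b.1 : ℕ) + 1 ≤ (τ b : ℕ) → τ b < τ c

open Classical in
/-- The set `𝒮𝒯(λ)` of spin tableaux of shape `lam`. -/
noncomputable def spinTableaux {n : ℕ} (lam : Fin n → ℕ) : Finset (Box lam → Fin n) :=
  Finset.univ.filter fun τ => IsSpinTableau τ

section weights

variable {n : ℕ} {lam : Fin n → ℕ} (τ : Box lam → Fin n)

/-- `b_{i,j}`: the number of boxes of entry `i` within the first `i` boxes of the column `j`. -/
def lowerIndex (i : Fin n) (j : ℕ) : ℕ :=
  (Finset.univ.filter fun b : Box lam =>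
    (b.2 : ℕ) = j ∧ τ b = i ∧ (b.1 : ℕ) < (i : ℕ)).card

/-- `a_{i,j}`: the sum of `b_{i,j}` and of the number of boxes of entry `< i` of the column `j` whose
right neighbor, if any, has entry `> i`. -/
def upperIndex (i : Fin n) (j : ℕ) : ℕ :=
  lowerIndex τ i j + (Finset.univ.filter fun b : Box lam =>
    (b.2 : ℕ) = j ∧ τ b < i ∧
      ∀ c : Box lam, c.1 = b.1 → (c.2 : ℕ) = (b.2 : ℕ) + 1 → i < τ c).card

/-- The box `b` is the last box with its entry in its column. -/
def IsLastInColumn (b : Box lam) : Prop :=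
  ∀ c : Box lam, (c.2 : ℕ) = (b.2 : ℕ) → τ c = τ b → c.1 ≤ b.1

open Classical in
/-- `N_τ`: the product, over the boxes `b` that are last of their entry in their column, of the
binomial coefficients `a_{i,j}` choose `b_{i,j}`, where `i` is the entry and `j` the column
of `b`. -/
noncomputable def tableauWeight : ℕ :=
  ∏ b ∈ Finset.univ.filter (fun b : Box lam => IsLastInColumn τ b),
    (upperIndex τ (τ b) b.2).choose (lowerIndex τ (τ b) b.2)

end weights

end SpinModule

namespace SpinModule

/-! ### Weights of the spin module -/

/-! Exterior products of elementary matrices, indexed by sets S of positive roots, are weight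
vectors of the spin module; the weight is ½ ∑ ±(ε_i - ε_j) over i < j, with sign + exactly on S.
Read S as a tournament in which i beats j when the pair {i, j} contributes ε_i - ε_j. Since ∑ ε_i =
0 on 𝔱, the weight is ∑ s_i ε_i, where s is the score vector. Hence the multiplicity of μ[λ] is the
number of tournaments with score vector λ (`spinMult_muWeight`).

These are counted by removing the last vertex (`card_score_eq_sum_isNested`). If A is the set of
vertices that beat it, the remaining tournament has score vector λ' - 1_A, where λ' is λ without its
last part. The number of such tournaments does not change when A is moved by a permutation fixing
λ', so A may be taken to be a final segment of each block of equal parts of λ', at the price of a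
product of binomial coefficients (`sum_finset_eq_sum_isFinalInFibers`). For such A the vector λ' -
1_A is again nonincreasing and the recursion continues. The outcome is a weighted sum over the
tournaments all of whose initial subtournaments have nonincreasing scores.

These nested tournaments are the spin tableaux (`Codes`, `sum_tableauWeight_eq`): the entries ≤ i of
a row r ≤ i are as many as the wins of r against the vertices ≤ i. So an entry i > r occurs in row
r, once, when r beats i, and row i has one entry i for each win of i against a smaller vertex.
Nestedness becomes monotonicity of the columns. The block of value j + 1 at stage i consists of the
rows < i whose entries ≤ i end in column j, and its binomial coefficient is that of a_{i,j} and
b_{i,j}. -/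

theorem ι_mul_contractLeft_prod {I M : Type*} [DecidableEq I] [AddCommGroup M] [Module ℂ M]
    (b : I → M) (p : I) (c : ℂ) (d : Module.Dual ℂ M) (hd : ∀ q, d (b q) = if p = q then c else 0)
    (l : List I) :
    ExteriorAlgebra.ι ℂ (b p) *
        CliffordAlgebra.contractLeft (Q := (0 : QuadraticForm ℂ M)) d
          (l.map fun q => ExteriorAlgebra.ι ℂ (b q)).prod =
      (c * l.count p) • (l.map fun q => ExteriorAlgebra.ι ℂ (b q)).prod := by
  induction l with
  | nil =>
    have := CliffordAlgebra.contractLeft_one (Q := (0 : QuadraticForm ℂ M)) d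
    simp only [List.map_nil, List.prod_nil]
    rw [show (1 : ExteriorAlgebra ℂ M) = (1 : CliffordAlgebra (0 : QuadraticForm ℂ M)) from rfl,
      this]
    simp
  | cons q l ih =>
    set y := (l.map fun q => ExteriorAlgebra.ι ℂ (b q)).prod with hy
    have h1 := CliffordAlgebra.contractLeft_ι_mul (Q := (0 : QuadraticForm ℂ M)) d (b q) y
    change CliffordAlgebra.contractLeft (Q := (0 : QuadraticForm ℂ M)) d
      (ExteriorAlgebra.ι ℂ (b q) * y) = _ at h1
    have h2 : ExteriorAlgebra.ι ℂ (b p) * ExteriorAlgebra.ι ℂ (b q) =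
        -(ExteriorAlgebra.ι ℂ (b q) * ExteriorAlgebra.ι ℂ (b p)) :=
      eq_neg_of_add_eq_zero_left (ExteriorAlgebra.ι_add_mul_swap _ _)
    have h3 : CliffordAlgebra.ι (0 : QuadraticForm ℂ M) (b q) = ExteriorAlgebra.ι ℂ (b q) := rfl
    -- The sign from moving `b p` past `b q` cancels the sign in the antiderivation rule, so wedge
    -- after contraction is a derivation of the exterior algebra. It multiplies each factor `b p` by
    -- `c` and kills the other generators, whence the count.
    rw [List.map_cons, List.prod_cons, ← hy, h1, h3, mul_sub, ← mul_assoc, h2, neg_mul, mul_assoc,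
      ih, hd, sub_neg_eq_add, mul_smul_comm, mul_smul_comm]
    by_cases hpq : p = q
    · subst hpq
      rw [if_pos rfl, List.count_cons_self, ← add_smul]
      congr 1
      push_cast
      ring
    · rw [if_neg hpq, List.count_cons_of_ne (Ne.symm hpq), zero_smul, zero_add]

/-- Wedge and contraction anticommute up to the scalar `d (b p) = c`, so the opposite order gives
`c` minus the previous eigenvalue. -/
theorem contractLeft_ι_mul_prod {I M : Type*} [DecidableEq I] [AddCommGroup M] [Module ℂ M]
    (b : I → M) (p : I) (c : ℂ) (d : Module.Dual ℂ M) (hd : ∀ q, d (b q) = if p = q then c else 0)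
    (l : List I) :
    CliffordAlgebra.contractLeft (Q := (0 : QuadraticForm ℂ M)) d (ExteriorAlgebra.ι ℂ (b p) *
          (l.map fun q => ExteriorAlgebra.ι ℂ (b q)).prod) =
      (c * (1 - l.count p)) • (l.map fun q => ExteriorAlgebra.ι ℂ (b q)).prod := by
  have h1 := CliffordAlgebra.contractLeft_ι_mul (Q := (0 : QuadraticForm ℂ M)) d (b p)
    (l.map fun q => ExteriorAlgebra.ι ℂ (b q)).prod
  change CliffordAlgebra.contractLeft (Q := (0 : QuadraticForm ℂ M)) d
      (ExteriorAlgebra.ι ℂ (b p) * _) = _ at h1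
  have h3 : CliffordAlgebra.ι (0 : QuadraticForm ℂ M) (b p) = ExteriorAlgebra.ι ℂ (b p) := rfl
  rw [h1, h3, ι_mul_contractLeft_prod b p c d hd, hd, if_pos rfl, ← sub_smul]
  congr 1
  ring

theorem ι_mul_contractLeft_prod_of_nodup {I M : Type*} [DecidableEq I] [AddCommGroup M] [Module ℂ M]
    (b : I → M) (p : I) (c : ℂ) (d : Module.Dual ℂ M) (hd : ∀ q, d (b q) = if p = q then c else 0)
    {l : List I} (hl : l.Nodup) [Decidable (p ∈ l)] :
    ExteriorAlgebra.ι ℂ (b p) *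
        CliffordAlgebra.contractLeft (Q := (0 : QuadraticForm ℂ M)) d
          (l.map fun q => ExteriorAlgebra.ι ℂ (b q)).prod =
      (c * if p ∈ l then 1 else 0) • (l.map fun q => ExteriorAlgebra.ι ℂ (b q)).prod := by
  rw [ι_mul_contractLeft_prod b p c d hd, List.Nodup.count hl]
  push_cast
  congr

theorem contractLeft_ι_mul_prod_of_nodup {I M : Type*} [DecidableEq I] [AddCommGroup M] [Module ℂ M]
    (b : I → M) (p : I) (c : ℂ) (d : Module.Dual ℂ M) (hd : ∀ q, d (b q) = if p = q then c else 0)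
    {l : List I} (hl : l.Nodup) [Decidable (p ∈ l)] :
    CliffordAlgebra.contractLeft (Q := (0 : QuadraticForm ℂ M)) d (ExteriorAlgebra.ι ℂ (b p) *
          (l.map fun q => ExteriorAlgebra.ι ℂ (b q)).prod) =
      (c * if p ∉ l then 1 else 0) • (l.map fun q => ExteriorAlgebra.ι ℂ (b q)).prod := by
  rw [contractLeft_ι_mul_prod b p c d hd, List.Nodup.count hl]
  by_cases h : p ∈ l <;> simp [h]

/-- Index pairs of positive roots. -/
abbrev PosIdx (n : ℕ) : Type := {p : Fin n × Fin n // p.1 < p.2}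

/-- Coordinates on the strictly upper triangular matrices. -/
noncomputable def uPlusEquiv (n : ℕ) : uPlus n ≃ₗ[ℂ] (PosIdx n → ℂ) where
  toFun X p := X.1.1 p.1.1 p.1.2
  map_add' _ _ := rfl
  map_smul' _ _ := rfl
  invFun f := ⟨⟨Matrix.of fun i j => if h : i < j then f ⟨(i, j), h⟩ else 0, by
      change ∑ i : Fin n, (if h : i < i then f ⟨(i, i), h⟩ else 0) = 0
      simp⟩, by
      intro i j hij
      simp [not_lt.2 hij]⟩
  left_inv X := by
    ext i j
    by_cases h : i < j
    · simp [h]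
    · simp [h, X.2 i j (not_lt.1 h)]
  right_inv f := by
    ext p
    have := p.2
    simp [this]

/-- The basis of elementary matrices of `𝔲⁺`. -/
noncomputable def uPlusBasis (n : ℕ) : Module.Basis (PosIdx n) ℂ (uPlus n) :=
  Module.Basis.ofEquivFun (uPlusEquiv n)

theorem uPlusBasis_val {n : ℕ} (p : PosIdx n) (i j : Fin n) :
    (uPlusBasis n p).1.1 i j = if p.1.1 = i ∧ p.1.2 = j then 1 else 0 := by
  have h := p.2
  have e : uPlusBasis n p = (uPlusEquiv n).symm (Pi.single p 1) := by
    rw [uPlusBasis, Module.Basis.coe_ofEquivFun]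
  rw [e]
  change (if h : i < j then (Pi.single p 1 : PosIdx n → ℂ) ⟨(i, j), h⟩ else 0) = _
  by_cases hij : i < j
  · rw [dif_pos hij, Pi.single_apply]
    congr 1
    rw [Subtype.ext_iff, Prod.ext_iff]
    simp [eq_comm]
  · rw [dif_neg hij, if_neg]
    rintro ⟨rfl, rfl⟩
    exact hij h

theorem upperPart_elem_of_lt {n : ℕ} (p : Idx n) (h : p.1.1 < p.1.2) :
    upperPart n (elem p) = uPlusBasis n ⟨p.1, h⟩ := by
  refine Subtype.ext (Subtype.ext (Matrix.ext fun i j => ?_))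
  rw [uPlusBasis_val]
  change (if i < j then (elem p).1.1 i j else 0) = _
  rw [elem_val]
  split_ifs with h1 h2 h3 <;> first | rfl | skip
  obtain ⟨rfl, rfl⟩ := h3
  exact absurd h h1

theorem upperPart_elem_of_gt {n : ℕ} (p : Idx n) (h : p.1.2 < p.1.1) :
    upperPart n (elem p) = 0 := by
  refine Subtype.ext (Subtype.ext (Matrix.ext fun i j => ?_))
  change (if i < j then (elem p).1.1 i j else 0) = 0
  rw [elem_val]
  split_ifs with h1 h2 <;> first | rfl | skip
  obtain ⟨rfl, rfl⟩ := h2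
  exact absurd h h1.not_gt

theorem pairing_elem {n : ℕ} (p : Idx n) (u : uPlus n) :
    pairing n (elem p) u = 4 * n * u.1.1 p.1.2 p.1.1 := by
  change 2 * (2 * (n : ℂ) * ((elem p).1.1 * u.1.1).trace) = _
  have : (elem p).1.1 = Matrix.single p.1.1 p.1.2 1 := rfl
  rw [this, Matrix.trace_single_mul, one_smul]
  ring

theorem vecAct_elem_of_lt {n : ℕ} (p : Idx n) (h : p.1.1 < p.1.2) (t : Spinors n) :
    vecAct n (elem p) t = ExteriorAlgebra.ι ℂ (uPlusBasis n ⟨p.1, h⟩) * t := by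
  have : pairing n (elem p) = 0 := by
    ext u
    rw [pairing_elem, u.2 _ _ h.le]
    simp
  rw [vecAct_apply, upperPart_elem_of_lt p h, this, map_zero, LinearMap.zero_apply, add_zero]

theorem vecAct_elem_of_gt {n : ℕ} (p : Idx n) (h : p.1.2 < p.1.1) (t : Spinors n) :
    vecAct n (elem p) t = CliffordAlgebra.contractLeft (Q := (0 : QuadraticForm ℂ (uPlus n)))
      (pairing n (elem p)) t := by
  rw [vecAct_apply, upperPart_elem_of_gt p h, map_zero, zero_mul, zero_add]

/-! ### The Cartan subalgebra acts diagonally on the exterior basis -/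

theorem adEnd_elem {n : ℕ} (H : cartan n) (p : Idx n) :
    adEnd n H (elem p) = (eps p.1.1 H - eps p.1.2 H) • elem p := by
  refine Subtype.ext (Subtype.ext (Matrix.ext fun i j => ?_))
  change (⁅H.1, (elem p).1⁆ : Sl n).1 i j =
    (H.1.1 p.1.1 p.1.1 - H.1.1 p.1.2 p.1.2) * (elem p).1.1 i j
  rw [cartan_lie_apply, elem_val]
  split_ifs with h
  · rw [h.1, h.2]
  · rw [mul_zero, mul_zero]

theorem spinEmbLinear_adEnd {n : ℕ} (H : cartan n) :
    spinEmbLinear n (adEnd n H) = (4 : ℂ)⁻¹ • ∑ p : Idx n,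
      ((eps p.1.1 H - eps p.1.2 H) * (2 * (n : ℂ))⁻¹) • (CliffordAlgebra.ι (quad n) (elem p) *
        CliffordAlgebra.ι (quad n) (elem ⟨p.1.swap, fun h => p.2 h.symm⟩)) := by
  have e2 : spinEmbLinear n (adEnd n H) = (4 : ℂ)⁻¹ • ∑ p : Idx n,
    CliffordAlgebra.ι (quad n) (adEnd n H (elem p)) * CliffordAlgebra.ι (quad n) (elemDual p) := rfl
  rw [e2]
  congr 1
  refine Finset.sum_congr rfl fun p _ => ?_
  rw [adEnd_elem, elemDual, map_smul, map_smul, smul_mul_smul_comm]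

theorem algHom_smul_sum_apply {M V I : Type*} [AddCommGroup M] [Module ℂ M] [AddCommGroup V]
    [Module ℂ V] [Fintype I] {Q : QuadraticForm ℂ M}
    (φ : CliffordAlgebra Q →ₐ[ℂ] Module.End ℂ V) (f : M → Module.End ℂ V)
    (hf : ∀ v, φ (CliffordAlgebra.ι Q v) = f v) (c : ℂ) (a : I → ℂ) (v w : I → M) (t : V) :
    φ (c • ∑ p, a p • (CliffordAlgebra.ι Q (v p) * CliffordAlgebra.ι Q (w p))) t =
      c • ∑ p, a p • f (v p) (f (w p) t) := by
  simp [hf]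

theorem cliffordMult_ι {n : ℕ} (v : qSpace n) :
    cliffordMult n (CliffordAlgebra.ι (quad n) v) = vecAct n v :=
  CliffordAlgebra.lift_ι_apply (vecAct n) (vecAct_sq n) v

theorem spinRep_apply {n : ℕ} (H : cartan n) (t : Spinors n) :
    spinRep n H t = (4 : ℂ)⁻¹ • ∑ p : Idx n, ((eps p.1.1 H - eps p.1.2 H) *
      (2 * (n : ℂ))⁻¹) • vecAct n (elem p) (vecAct n (elem ⟨p.1.swap, fun h => p.2 h.symm⟩) t) := by
  have e : spinRep n H = cliffordMult n (spinEmbLinear n (adEnd n H)) := by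
    rw [spinRep, LieHom.comp_apply, LieHom.comp_apply]
    rfl
  rw [e, spinEmbLinear_adEnd]
  exact algHom_smul_sum_apply (cliffordMult n) (vecAct n) cliffordMult_ι _ _ _ _ _

/-- The edge relation of the tournament attached to a set of positive roots: it is oriented from
`i` to `j` if the basis vector contributes `ε_i - ε_j`. -/
def edge {n : ℕ} (S : Finset (PosIdx n)) (i j : Fin n) : Prop :=
  (∃ h : i < j, ⟨(i, j), h⟩ ∈ S) ∨ (∃ h : j < i, (⟨(j, i), h⟩ : PosIdx n) ∉ S)

theorem edge_of_lt {n : ℕ} {S : Finset (PosIdx n)} {i j : Fin n} (h : i < j) :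
    edge S i j ↔ (⟨(i, j), h⟩ : PosIdx n) ∈ S := by
  simp [edge, h, h.not_gt]

theorem edge_of_gt {n : ℕ} {S : Finset (PosIdx n)} {i j : Fin n} (h : j < i) :
    edge S i j ↔ (⟨(j, i), h⟩ : PosIdx n) ∉ S := by
  simp [edge, h, h.not_gt]

/-- Turns a basis vector into a list product, the form in which the contraction formulas apply. The
order of the factors plays no role afterwards. -/
theorem exists_list_basis_eq {n : ℕ} [LinearOrder (PosIdx n)] (S : Finset (PosIdx n)) :
    ∃ l : List (PosIdx n), l.Nodup ∧ (∀ p, p ∈ l ↔ p ∈ S) ∧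
      (uPlusBasis n).ExteriorAlgebra S =
        (l.map fun q => ExteriorAlgebra.ι ℂ (uPlusBasis n q)).prod := by
  refine ⟨List.ofFn (S.orderEmbOfFin rfl), ?_, fun p => ?_, ?_⟩
  · exact List.nodup_ofFn.2 (S.orderEmbOfFin rfl).injective
  · rw [List.mem_ofFn', Finset.range_orderEmbOfFin, Finset.mem_coe]
  · rw [ExteriorAlgebra.basis_apply_ofCard (uPlusBasis n) (s := S) rfl,
      ExteriorAlgebra.ιMulti_family, ExteriorAlgebra.ιMulti_apply, List.map_ofFn]
    rfl

/-- For `p = (i, j)` with i < j the product is wedge after contraction, which tests membership in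
`S`; for i > j it is contraction after wedge, which tests non-membership. These are the two clauses
of `edge`. The scalar 4n comes from `pairing`. -/
theorem vecAct_elem_prod {n : ℕ} (p : Idx n) {S : Finset (PosIdx n)} {l : List (PosIdx n)}
    (hl : l.Nodup) (hS : ∀ p, p ∈ l ↔ p ∈ S) [Decidable (edge S p.1.1 p.1.2)] :
    vecAct n (elem p) (vecAct n (elem ⟨p.1.swap, fun h => p.2 h.symm⟩)
        (l.map fun q => ExteriorAlgebra.ι ℂ (uPlusBasis n q)).prod) =
      (4 * (n : ℂ) * if edge S p.1.1 p.1.2 then 1 else 0) •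
        (l.map fun q => ExteriorAlgebra.ι ℂ (uPlusBasis n q)).prod := by
  classical
  rcases lt_or_gt_of_ne p.2 with h | h
  · have hd : ∀ q, pairing n (elem (⟨p.1.swap, fun h => p.2 h.symm⟩ : Idx n)) (uPlusBasis n q) =
        if (⟨p.1, h⟩ : PosIdx n) = q then 4 * (n : ℂ) else 0 := by
      intro q
      rw [pairing_elem, uPlusBasis_val, mul_ite, mul_one, mul_zero]
      refine if_congr ?_ rfl rfl
      rw [Subtype.ext_iff, Prod.ext_iff]
      simp [eq_comm]
    rw [vecAct_elem_of_lt p h, vecAct_elem_of_gt _ h,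
      ι_mul_contractLeft_prod_of_nodup (uPlusBasis n) ⟨p.1, h⟩ _ _ hd hl]
    congr 2
    exact if_congr ((hS _).trans (edge_of_lt h).symm) rfl rfl
  · have hd : ∀ q, pairing n (elem p) (uPlusBasis n q) =
        if (⟨p.1.swap, h⟩ : PosIdx n) = q then 4 * (n : ℂ) else 0 := by
      intro q
      rw [pairing_elem, uPlusBasis_val, mul_ite, mul_one, mul_zero]
      refine if_congr ?_ rfl rfl
      rw [Subtype.ext_iff, Prod.ext_iff]
      simp [eq_comm]
    rw [vecAct_elem_of_gt p h, vecAct_elem_of_lt _ h,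
      contractLeft_ι_mul_prod_of_nodup (uPlusBasis n) ⟨p.1.swap, h⟩ _ _ hd hl]
    congr 2
    exact if_congr ((hS _).not.trans (edge_of_gt h).symm) rfl rfl

open Classical in
/-- The weight of a basis vector of the spin module. -/
noncomputable def rootSetWeight {n : ℕ} (S : Finset (PosIdx n)) : Module.Dual ℂ (cartan n) :=
  (2 : ℂ)⁻¹ • ∑ p : Idx n, if edge S p.1.1 p.1.2 then eps p.1.1 - eps p.1.2 else 0

theorem exists_basis_spinors (n : ℕ) : ∃ B : Module.Basis (Finset (PosIdx n)) ℂ (Spinors n),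
    ∀ S (H : cartan n), spinRep n H (B S) = rootSetWeight S H • B S := by
  classical
  let _ : LinearOrder (PosIdx n) := linearOrderOfSTO WellOrderingRel
  refine ⟨(uPlusBasis n).ExteriorAlgebra, fun S H => ?_⟩
  obtain ⟨l, hl, hS, he⟩ := exists_list_basis_eq S
  rw [he, spinRep_apply]
  have key : ∀ (V : Type) [AddCommGroup V] [Module ℂ V] (x : V) (f : Idx n → V),
      (∀ p, f p = (4 * (n : ℂ) * if edge S p.1.1 p.1.2 then 1 else 0) • x) →
      (4 : ℂ)⁻¹ • ∑ p : Idx n, ((eps p.1.1 H - eps p.1.2 H) * (2 * (n : ℂ))⁻¹) • f p =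
        rootSetWeight S H • x := by
    intro V _ _ x f hf
    -- One factor ½ of ¼ is that of `rootSetWeight`; the other cancels against `(2n)⁻¹ * 4n = 2`.
    rw [rootSetWeight, LinearMap.smul_apply, LinearMap.sum_apply, smul_assoc,
      Finset.sum_smul, show (4 : ℂ)⁻¹ = 2⁻¹ * 2⁻¹ by norm_num, mul_smul]
    congr 1
    rw [Finset.smul_sum]
    refine Finset.sum_congr rfl fun p _ => ?_
    have hn := natCast_ne_zero_of_idx p
    rw [hf, smul_smul, smul_smul]
    congr 1
    split_ifs
    · rw [LinearMap.sub_apply]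
      field_simp
      ring
    · simp
  exact key _ _ _ fun p => vecAct_elem_prod p hl hS

theorem finrank_iInf_eigenspace {ι A V : Type*} [Fintype ι] [AddCommGroup V] [Module ℂ V]
    (B : Module.Basis ι ℂ V) (ρ : A → Module.End ℂ V) (wt : ι → A → ℂ)
    (h : ∀ i a, ρ a (B i) = wt i a • B i) (μ : A → ℂ) :
    Module.finrank ℂ (⨅ a, Module.End.eigenspace (ρ a) (μ a) : Submodule ℂ V) =
      Nat.card {i // wt i = μ} := by
  classical
  have e : (⨅ a, Module.End.eigenspace (ρ a) (μ a) : Submodule ℂ V) =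
      Submodule.span ℂ (Set.range fun i : {i // wt i = μ} => B i) := by
    apply le_antisymm
    · intro v hv
      rw [Submodule.mem_iInf] at hv
      have key : ∀ i, wt i ≠ μ → B.repr v i = 0 := by
        intro i hi
        -- Some operator separates the weight of `B i` from `μ`; comparing `i`-th coordinates of its
        -- eigenvalue equation kills the coordinate of `v`.
        obtain ⟨a, ha⟩ := Function.ne_iff.1 hi
        have h1 := Module.End.mem_eigenspace_iff.1 (hv a)
        have h2 : ρ a v = ∑ j, (B.repr v j * wt j a) • B j := by
          conv_lhs => rw [← B.sum_repr v]
          simp only [map_sum, map_smul, h, smul_smul]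
        have h3 : B.repr (ρ a v) i = B.repr v i * wt i a := by
          rw [h2]
          exact congrFun (B.repr_sum_self fun j => B.repr v j * wt j a) i
        rw [h1] at h3
        simp only [map_smul, Finsupp.smul_apply, smul_eq_mul] at h3
        have h4 : (wt i a - μ a) * B.repr v i = 0 := by linear_combination -h3
        exact (mul_eq_zero.1 h4).resolve_left (sub_ne_zero.2 ha)
      rw [← B.sum_repr v]
      refine Submodule.sum_mem _ fun i _ => ?_
      by_cases hi : wt i = μ
      · exact Submodule.smul_mem _ _ (Submodule.subset_span ⟨⟨i, hi⟩, rfl⟩)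
      · rw [key i hi, zero_smul]
        exact Submodule.zero_mem _
    · rw [Submodule.span_le]
      rintro _ ⟨i, rfl⟩
      simp only [SetLike.mem_coe, Submodule.mem_iInf, Module.End.mem_eigenspace_iff]
      intro a
      rw [h, i.2]
  rw [e, finrank_span_eq_card, Nat.card_eq_fintype_card]
  exact B.linearIndependent.comp _ Subtype.val_injective

theorem spinMult_eq_card {n : ℕ} (μ : Module.Dual ℂ (cartan n)) :
    spinMult n μ = Nat.card {S : Finset (PosIdx n) // rootSetWeight S = μ} := by
  obtain ⟨B, hB⟩ := exists_basis_spinors n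
  rw [spinMult, spinWeightSpace, finrank_iInf_eigenspace B (fun H => spinRep n H)
    (fun S H => rootSetWeight S H) hB (fun H => μ H)]
  refine Nat.card_congr (Equiv.subtypeEquivRight fun S => ?_)
  exact ⟨fun h => LinearMap.ext (congrFun h), fun h => h ▸ rfl⟩

/-! ### Tournaments -/

/-- Tournaments on `Fin n`, as orientations `t i j` (`i` beats `j`) of the complete graph. -/
abbrev Tournament (n : ℕ) : Type :=
  {t : Fin n → Fin n → Bool // (∀ i, t i i = false) ∧ ∀ i j, i ≠ j → t i j = !t j i}

/-- The score vector (number of wins) of a tournament. -/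
def score {n : ℕ} (t : Tournament n) (i : Fin n) : ℕ :=
  (Finset.univ.filter fun j => t.1 i j).card

theorem score_add_losses {n : ℕ} (t : Tournament n) (i : Fin n) :
    score t i + (Finset.univ.filter fun j => t.1 j i).card = n - 1 := by
  have h1 : Disjoint (Finset.univ.filter fun j => t.1 i j)
      (Finset.univ.filter fun j => t.1 j i) := by
    rw [Finset.disjoint_filter]
    intro j _ h h'
    by_cases hij : i = j
    · subst hij
      rw [t.2.1] at h
      exact absurd h (by simp)
    · rw [t.2.2 i j hij, h'] at h
      exact absurd h (by simp)
  rw [score, ← Finset.card_union_of_disjoint h1]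
  have h2 : (Finset.univ.filter fun j => t.1 i j) ∪ (Finset.univ.filter fun j => t.1 j i) =
      Finset.univ.erase i := by
    ext j
    simp only [Finset.mem_union, Finset.mem_filter, Finset.mem_univ, true_and, Finset.mem_erase,
      and_true]
    by_cases hij : i = j
    · subst hij
      simp [t.2.1]
    · rw [t.2.2 i j hij]
      cases t.1 j i <;> simp [Ne.symm hij]
  rw [h2, Finset.card_erase_of_mem (Finset.mem_univ _), Finset.card_univ, Fintype.card_fin]

/-- Wins and losses have equal totals, and together they count the n(n-1) ordered pairs. -/
theorem sum_score {n : ℕ} (t : Tournament n) : ∑ i, score t i = n.choose 2 := by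
  have h1 : ∑ i, score t i = ∑ i, (Finset.univ.filter fun j => t.1 j i).card := by
    simp only [score, Finset.card_filter]
    rw [Finset.sum_comm]
  have h2 : ∑ i, (score t i + (Finset.univ.filter fun j => t.1 j i).card) = n * (n - 1) := by
    simp [score_add_losses]
  rw [Finset.sum_add_distrib, ← h1] at h2
  rw [Nat.choose_two_right, ← h2]
  omega

/-- The tournament attached to a set of positive roots. -/
noncomputable def tournamentEquiv (n : ℕ) : Finset (PosIdx n) ≃ Tournament n := by
  classical
  exact
  { toFun := fun S => ⟨fun i j => decide (edge S i j), fun i => by simp [edge], fun i j hij => by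
      rcases lt_or_gt_of_ne hij with h | h
      · simp [edge_of_lt h, edge_of_gt h]
      · simp [edge_of_lt h, edge_of_gt h]⟩
    invFun := fun t => Finset.univ.filter fun p => t.1 p.1.1 p.1.2
    left_inv := fun S => by
      ext p
      simp [edge_of_lt p.2]
    right_inv := fun t => by
      refine Subtype.ext (funext fun i => funext fun j => ?_)
      rcases lt_trichotomy i j with h | h | h
      · simp [edge_of_lt h]
      · subst h
        simp [edge, t.2.1]
      · simp [edge_of_gt h, t.2.2 i j h.ne'] }

theorem tournamentEquiv_apply {n : ℕ} (S : Finset (PosIdx n)) (i j : Fin n) :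
    (tournamentEquiv n S).1 i j = true ↔ edge S i j := by
  simp [tournamentEquiv]

/-! ### Weights as score vectors -/

theorem sum_diag_eq_zero {n : ℕ} (H : cartan n) : ∑ i, eps i H = 0 := by
  have h : H.1.1.trace = 0 := H.1.2
  exact h

theorem rootSetWeight_apply {n : ℕ} (S : Finset (PosIdx n)) (H : cartan n) :
    rootSetWeight S H = ∑ i, (score (tournamentEquiv n S) i : ℂ) * eps i H := by
  classical
  set t := tournamentEquiv n S with ht
  have e0 : ∑ p : Idx n, (if edge S p.1.1 p.1.2 then eps p.1.1 H - eps p.1.2 H else 0) =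
      ∑ i, ∑ j, if t.1 i j then eps i H - eps j H else 0 := by
    rw [← Fintype.sum_prod_type'
      (f := fun i j => if t.1 i j then eps i H - eps j H else 0)]
    rw [← Finset.sum_subtype (Finset.univ.filter fun q : Fin n × Fin n => q.1 ≠ q.2) (by simp)
      (fun q => if edge S q.1 q.2 then eps q.1 H - eps q.2 H else 0), Finset.sum_filter]
    refine Finset.sum_congr rfl fun q _ => ?_
    rw [if_congr (tournamentEquiv_apply S q.1 q.2) rfl rfl, ite_eq_left_iff, not_not]
    intro h
    rw [h, sub_self, ite_self]
  have e1 : ∑ i, ∑ j, (if t.1 i j then eps i H - eps j H else 0) =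
      ∑ i, (score t i : ℂ) * eps i H -
        ∑ j, ((Finset.univ.filter fun i => t.1 i j).card : ℂ) * eps j H := by
    have : ∀ i j, (if t.1 i j then eps i H - eps j H else 0) =
        (if t.1 i j then eps i H else 0) - (if t.1 i j then eps j H else 0) := by
      intro i j
      split_ifs <;> simp
    simp only [this, Finset.sum_sub_distrib]
    congr 1
    · refine Finset.sum_congr rfl fun i _ => ?_
      rw [← Finset.sum_filter, Finset.sum_const, nsmul_eq_mul]
      rfl
    · rw [Finset.sum_comm]
      refine Finset.sum_congr rfl fun i _ => ?_
      rw [← Finset.sum_filter, Finset.sum_const, nsmul_eq_mul]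
  -- The losses of a vertex are n - 1 minus its wins, and the constant n - 1 disappears because the
  -- trace is zero. So the losses double the contribution of the wins, which absorbs the factor ½.
  have e2 : ∑ j, ((Finset.univ.filter fun i => t.1 i j).card : ℂ) * eps j H =
      - ∑ i, (score t i : ℂ) * eps i H := by
    rw [eq_neg_iff_add_eq_zero, ← Finset.sum_add_distrib]
    have : ∀ j, ((Finset.univ.filter fun i => t.1 i j).card : ℂ) * eps j H +
        (score t j : ℂ) * eps j H = ((n - 1 : ℕ) : ℂ) * eps j H := by
      intro j
      rw [← score_add_losses t j]
      push_cast
      ring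
    simp only [this]
    rw [← Finset.mul_sum, sum_diag_eq_zero, mul_zero]
  have e3 : rootSetWeight S H = (2 : ℂ)⁻¹ *
      ∑ p : Idx n, (if edge S p.1.1 p.1.2 then eps p.1.1 H - eps p.1.2 H else 0) := by
    rw [rootSetWeight, LinearMap.smul_apply, LinearMap.sum_apply, smul_eq_mul]
    congr 1
    refine Finset.sum_congr rfl fun p _ => ?_
    split_ifs <;> simp
  rw [e3, e0, e1, e2]
  ring

/-- Summation by parts. For fundamental weights the boundary term `a m` multiplies the trace and
vanishes. -/
theorem sum_sub_succ_mul_sum_range (a h : ℕ → ℂ) (m : ℕ) :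
    ∑ i ∈ Finset.range m, (a i - a (i + 1)) * ∑ k ∈ Finset.range (i + 1), h k =
      ∑ k ∈ Finset.range (m + 1), (a k - a m) * h k := by
  induction m with
  | zero => simp
  | succ m ih =>
    rw [Finset.sum_range_succ, ih, Finset.sum_range_succ _ (m + 1), sub_self, zero_mul, add_zero,
      Finset.mul_sum, ← Finset.sum_add_distrib]
    refine Finset.sum_congr rfl fun k _ => ?_
    ring

theorem muWeight_apply {n : ℕ} (hn : 1 ≤ n) (lam : Fin n → ℕ) (H : cartan n) :
    muWeight lam H = ∑ i, (lam i : ℂ) * eps i H := by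
  obtain ⟨m, rfl⟩ : ∃ m, n = m + 1 := ⟨n - 1, by omega⟩
  set a : ℕ → ℂ := fun i => if h : i < m + 1 then (lam ⟨i, h⟩ : ℂ) else 0 with ha
  set g : ℕ → ℂ := fun i => if h : i < m + 1 then eps ⟨i, h⟩ H else 0 with hg
  have ha' : ∀ i : Fin (m + 1), a i = lam i := fun i => by rw [ha]; exact dif_pos i.2
  have hg' : ∀ i : Fin (m + 1), g i = eps i H := fun i => by rw [hg]; exact dif_pos i.2
  have e1 : ∀ i : Fin (m + 1), fundWeight i H = ∑ k ∈ Finset.range (i + 1), g k := by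
    intro i
    rw [fundWeight, LinearMap.sum_apply, Finset.range_eq_Ico, Nat.Ico_zero_eq_range,
      Nat.range_succ_eq_Iic, ← Fin.map_valEmbedding_Iic, Finset.sum_map]
    exact Finset.sum_congr rfl fun k _ => (hg' k).symm
  have e2 : muWeight lam H = ∑ i ∈ Finset.range m,
      (a i - a (i + 1)) * ∑ k ∈ Finset.range (i + 1), g k := by
    rw [Finset.sum_range, muWeight, LinearMap.sum_apply]
    refine Finset.sum_congr rfl fun i _ => ?_
    rw [LinearMap.smul_apply, e1, smul_eq_mul]
    congr 2
    · exact (ha' ⟨i, _⟩).symm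
    · exact (ha' ⟨i + 1, _⟩).symm
  rw [e2, sum_sub_succ_mul_sum_range, Finset.sum_range]
  simp only [ha', hg', sub_mul, Finset.sum_sub_distrib]
  rw [← Finset.mul_sum, sum_diag_eq_zero, mul_zero, sub_zero]

/-- The diagonal matrix `E_{ii} - E_{jj}`. -/
noncomputable def coroot {n : ℕ} (i j : Fin n) : cartan n :=
  ⟨⟨Matrix.diagonal (Pi.single i 1 - Pi.single j 1), by
    change (Matrix.diagonal (Pi.single i 1 - Pi.single j 1) : Matrix (Fin n) (Fin n) ℂ).trace = 0
    simp [Matrix.trace_diagonal]⟩, Matrix.isDiag_diagonal _⟩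

theorem sum_mul_eps_coroot {n : ℕ} (f : Fin n → ℂ) (i j : Fin n) :
    ∑ k, f k * eps k (coroot i j) = f i - f j := by
  have : ∀ k, eps k (coroot i j) =
      (Pi.single i 1 : Fin n → ℂ) k - (Pi.single j 1 : Fin n → ℂ) k := by
    intro k
    change (Matrix.diagonal (Pi.single i 1 - Pi.single j 1) : Matrix (Fin n) (Fin n) ℂ) k k = _
    simp
  simp [this, mul_sub, Pi.single_apply]

/-- Coroots detect only differences of coordinates; the common total n(n-1)/2 of both vectors
removes the remaining constant shift. -/
theorem rootSetWeight_eq_muWeight_iff {n : ℕ} (hn : 1 ≤ n) {lam : Fin n → ℕ}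
    (hlam : ∑ i, lam i = n.choose 2) (S : Finset (PosIdx n)) :
    rootSetWeight S = muWeight lam ↔ score (tournamentEquiv n S) = lam := by
  constructor
  · intro h
    have key : ∀ i j, (score (tournamentEquiv n S) i : ℂ) - score (tournamentEquiv n S) j =
        lam i - lam j := by
      intro i j
      have := LinearMap.congr_fun h (coroot i j)
      rw [rootSetWeight_apply, muWeight_apply hn, sum_mul_eps_coroot (fun k => (_ : ℂ)),
        sum_mul_eps_coroot (fun k => (_ : ℂ))] at this
      exact this
    funext i
    have h1 := Finset.sum_congr (rfl : (Finset.univ : Finset (Fin n)) = Finset.univ)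
      fun j _ => key i j
    have h2 : ∑ j, (score (tournamentEquiv n S) j : ℂ) = ∑ j, (lam j : ℂ) := by
      exact_mod_cast (sum_score _).trans hlam.symm
    rw [Finset.sum_sub_distrib, Finset.sum_sub_distrib, h2] at h1
    simp only [Finset.sum_const, Finset.card_univ, Fintype.card_fin, nsmul_eq_mul] at h1
    have hn0 : (n : ℂ) ≠ 0 := by
      exact_mod_cast (by omega : n ≠ 0)
    have := mul_left_cancel₀ hn0 (sub_left_inj.1 h1)
    exact_mod_cast this
  · intro h
    ext H
    rw [rootSetWeight_apply, muWeight_apply hn, h]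

theorem spinMult_muWeight {n : ℕ} (hn : 1 ≤ n) {lam : Fin n → ℕ}
    (hlam : ∑ i, lam i = n.choose 2) :
    spinMult n (muWeight lam) =
      (Finset.univ.filter fun t : Tournament n => score t = lam).card := by
  rw [spinMult_eq_card, ← Fintype.card_subtype, ← Nat.card_eq_fintype_card]
  exact Nat.card_congr ((tournamentEquiv n).subtypeEquiv (rootSetWeight_eq_muWeight_iff hn hlam))

/-! ### Sums over subsets that are symmetric under a Young subgroup -/

/-- The numbers of elements of `A` in the fibers of `c`. -/
def fiberProfile {m : ℕ} (c : Fin m → ℕ) (A : Finset (Fin m)) (v : ℕ) : ℕ :=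
  (A.filter fun r => c r = v).card

open Classical in
-- A set with prescribed profile is an independent choice, in each fiber of `c`, of a subset of
-- prescribed size.
theorem card_fiberProfile_eq {m : ℕ} (c : Fin m → ℕ) (K : ℕ) (hK : ∀ r, c r < K)
    (G : Finset (Fin m)) :
    (Finset.univ.filter fun A => fiberProfile c A = fiberProfile c G).card =
      ∏ v ∈ Finset.range K,
        (Finset.univ.filter fun r => c r = v).card.choose (G.filter fun r => c r = v).card := by
  rw [Finset.prod_range]
  have : ∀ v : Fin K, (Finset.univ.filter fun r => c r = v).card.choose
      (G.filter fun r => c r = v).card =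
      ((Finset.univ.filter fun r => c r = v).powersetCard (fiberProfile c G v)).card := by
    intro v
    rw [Finset.card_powersetCard]
    rfl
  simp only [this]
  rw [← Fintype.card_piFinset]
  refine Finset.card_nbij' (fun A v => A.filter fun r => c r = v)
    (fun g => Finset.univ.filter fun r => r ∈ g ⟨c r, hK r⟩) ?_ ?_ ?_ ?_
  · intro A hA
    have hA' := (Finset.mem_filter.1 hA).2
    refine Fintype.mem_piFinset.2 fun v => Finset.mem_powersetCard.2 ⟨?_, congrFun hA' v⟩
    exact Finset.filter_subset_filter _ (Finset.subset_univ _)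
  · intro g hg
    have hg' : ∀ v : Fin K, g v ⊆ (Finset.univ.filter fun r => c r = v) ∧
        (g v).card = fiberProfile c G v := fun v =>
      Finset.mem_powersetCard.1 (Fintype.mem_piFinset.1 hg v)
    refine Finset.mem_filter.2 ⟨Finset.mem_univ _, funext fun v => ?_⟩
    by_cases hv : v < K
    · rw [← (hg' ⟨v, hv⟩).2]
      refine congrArg Finset.card (Finset.ext fun r => ?_)
      simp only [Finset.mem_filter, Finset.mem_univ, true_and]
      constructor
      · rintro ⟨h, rfl⟩
        exact h
      · intro h
        have := (Finset.mem_filter.1 ((hg' ⟨v, hv⟩).1 h)).2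
        simp only at this
        subst this
        exact ⟨h, rfl⟩
    · have : ∀ B : Finset (Fin m), fiberProfile c B v = 0 := by
        intro B
        refine Finset.card_eq_zero.2 (Finset.filter_eq_empty_iff.2 fun r _ h => hv ?_)
        rw [← h]
        exact hK r
      rw [this, this]
  · intro A _
    ext r
    simp
  · intro g hg
    have hg' : ∀ v : Fin K, g v ⊆ (Finset.univ.filter fun r => c r = v) := fun v =>
      (Finset.mem_powersetCard.1 (Fintype.mem_piFinset.1 hg v)).1
    funext v
    ext r
    simp only [Finset.mem_filter, Finset.mem_univ, true_and]
    constructor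
    · rintro ⟨h, hr⟩
      have : (⟨c r, hK r⟩ : Fin K) = v := Fin.ext hr
      rwa [this] at h
    · intro h
      have hr := (Finset.mem_filter.1 (hg' v h)).2
      have : (⟨c r, hK r⟩ : Fin K) = v := Fin.ext hr
      rw [this]
      exact ⟨h, hr⟩

/-- `A` meets every fiber of `c` in a final segment. -/
def IsFinalInFibers {m : ℕ} (c : Fin m → ℕ) (A : Finset (Fin m)) : Prop :=
  ∀ r r', r ≤ r' → c r = c r' → r ∈ A → r' ∈ A

/-- If `r` lies in `A` but not in `B`, then in the fiber of `r` the set `B` stays above `r`, hence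
is strictly smaller than `A`, against the equality of profiles. Applied both ways, it shows that the
final representative of an orbit is unique. -/
theorem IsFinalInFibers.subset {m : ℕ} {c : Fin m → ℕ} {A B : Finset (Fin m)}
    (hA : IsFinalInFibers c A) (hB : IsFinalInFibers c B)
    (h : fiberProfile c A = fiberProfile c B) : A ⊆ B := by
  intro r hr
  by_contra hrB
  have h1 : (B.filter fun s => c s = c r) ⊂ (A.filter fun s => c s = c r) := by
    rw [Finset.ssubset_iff_of_subset]
    · exact ⟨r, by simp [hr], by simp [hrB]⟩
    · intro s hs
      rw [Finset.mem_filter] at hs ⊢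
      refine ⟨hA r s ?_ hs.2.symm hr, hs.2⟩
      by_contra hlt
      exact hrB (hB s r (not_le.1 hlt).le hs.2 hs.1)
  have h2 := Finset.card_lt_card h1
  have h3 := congrFun h (c r)
  rw [fiberProfile, fiberProfile] at h3
  omega

theorem exists_perm_isFinalInFibers {m : ℕ} {c : Fin m → ℕ} (hc : Antitone c)
    (A : Finset (Fin m)) :
    ∃ σ : Equiv.Perm (Fin m), c ∘ σ = c ∧ IsFinalInFibers c (A.map σ.toEmbedding) := by
  -- Sorting this key in decreasing order sorts by `c` first and puts the elements of `A` last in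
  -- each fiber. As `c` is already sorted, the sorting permutation preserves it.
  set g : Fin m → ℕᵒᵈ := fun r => OrderDual.toDual (2 * c r + if r ∈ A then 0 else 1) with hg
  set σ := Tuple.sort g
  have hσ := Tuple.monotone_sort g
  have hσ' : ∀ r r', r ≤ r' → 2 * c (σ r') + (if σ r' ∈ A then 0 else 1) ≤
      2 * c (σ r) + (if σ r ∈ A then 0 else 1) := fun r r' h => hσ h
  have h1 : Antitone (c ∘ σ) := by
    intro r r' h
    have := hσ' r r' h
    simp only [Function.comp_apply]
    split_ifs at this <;> omega
  have h2 : c ∘ σ = c := Tuple.unique_antitone (f := c) (σ := σ) (τ := Equiv.refl _) h1 hc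
  have h3 : c ∘ σ.symm = c := by
    conv_lhs => rw [← h2]
    funext r
    simp
  refine ⟨σ.symm, h3, ?_⟩
  intro r r' hr hcr hrA
  rw [Finset.mem_map_equiv, Equiv.symm_symm] at hrA ⊢
  have := hσ' r r' hr
  have e1 : c (σ r) = c r := congrFun h2 r
  have e2 : c (σ r') = c r' := congrFun h2 r'
  by_contra h
  rw [if_pos hrA, if_neg h, e1, e2, hcr] at this
  omega

theorem fiberProfile_map {m : ℕ} {c : Fin m → ℕ} (A : Finset (Fin m)) (σ : Equiv.Perm (Fin m))
    (h : c ∘ σ = c) : fiberProfile c (A.map σ.toEmbedding) = fiberProfile c A := by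
  funext v
  rw [fiberProfile, fiberProfile, Finset.filter_map, Finset.card_map]
  congr 1
  refine Finset.filter_congr fun r _ => ?_
  have := congrFun h r
  simp only [Function.comp_apply] at this
  simp [this]

open Classical in
-- `f` is constant on the orbits of the Young subgroup fixing `c`. Each orbit contains exactly one
-- final set, and the product of binomial coefficients is its size.
theorem sum_finset_eq_sum_isFinalInFibers {m : ℕ} {c : Fin m → ℕ} (hc : Antitone c) {K : ℕ}
    (hK : ∀ r, c r < K) (f : Finset (Fin m) → ℕ)
    (hf : ∀ σ : Equiv.Perm (Fin m), c ∘ σ = c → ∀ A, f (A.map σ.toEmbedding) = f A) :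
    ∑ A, f A = ∑ A ∈ Finset.univ.filter (IsFinalInFibers c), (∏ v ∈ Finset.range K,
        (Finset.univ.filter fun r => c r = v).card.choose (A.filter fun r => c r = v).card) *
          f A := by
  have h1 : ∀ A, f A = ∑ G ∈ Finset.univ.filter (IsFinalInFibers c),
      if fiberProfile c A = fiberProfile c G then f G else 0 := by
    intro A
    obtain ⟨σ, hσ, hG⟩ := exists_perm_isFinalInFibers hc A
    rw [Finset.sum_eq_single (A.map σ.toEmbedding)]
    · rw [fiberProfile_map A σ hσ, if_pos rfl, hf σ hσ]
    · intro G hG' hne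
      rw [if_neg]
      intro h
      rw [← fiberProfile_map A σ hσ] at h
      have hG'' := (Finset.mem_filter.1 hG').2
      exact hne ((hG''.subset hG h.symm).antisymm (hG.subset hG'' h))
    · intro h
      exact absurd (Finset.mem_filter.2 ⟨Finset.mem_univ _, hG⟩) h
  rw [Finset.sum_congr rfl fun A _ => h1 A, Finset.sum_comm]
  refine Finset.sum_congr rfl fun G _ => ?_
  rw [← Finset.sum_filter, Finset.sum_const, smul_eq_mul, card_fiberProfile_eq c K hK]

/-! ### Nested tournaments -/

/-- The tournament with vertices relabeled. -/
def Tournament.relabel {n : ℕ} (σ : Equiv.Perm (Fin n)) (t : Tournament n) : Tournament n :=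
  ⟨fun i j => t.1 (σ i) (σ j), fun _ => t.2.1 _, fun _ _ h => t.2.2 _ _ (σ.injective.ne h)⟩

theorem score_relabel {n : ℕ} (σ : Equiv.Perm (Fin n)) (t : Tournament n) (i : Fin n) :
    score (t.relabel σ) i = score t (σ i) := by
  refine Finset.card_equiv σ fun j => ?_
  rw [Finset.mem_filter_univ, Finset.mem_filter_univ]
  rfl

/-- The number of wins of `r` against the vertices `≤ i`. -/
def partialScore {n : ℕ} (t : Tournament n) (i r : Fin n) : ℕ :=
  (Finset.univ.filter fun j => j ≤ i ∧ t.1 r j).card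

/-- All initial subtournaments have nonincreasing score vectors. -/
def IsNested {n : ℕ} (t : Tournament n) : Prop :=
  ∀ i r r', r ≤ r' → r' ≤ i → partialScore t i r' ≤ partialScore t i r

/-- The contribution of the vertex `i` to the weight of a nested tournament. -/
def stepWeight {n : ℕ} (K : ℕ) (t : Tournament n) (i : Fin n) : ℕ :=
  ∏ v ∈ Finset.range K,
    (Finset.univ.filter fun r => r < i ∧ partialScore t i r = v).card.choose
      (Finset.univ.filter fun r => r < i ∧ partialScore t i r = v ∧ t.1 r i).card

theorem score_lt {n : ℕ} (t : Tournament n) (i : Fin n) : score t i < n := by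
  have := score_add_losses t i
  have := i.pos
  omega

theorem partialScore_eq_score {n : ℕ} (t : Tournament n) {i : Fin n} (hi : ∀ j, j ≤ i)
    (r : Fin n) : partialScore t i r = score t r := by
  simp [partialScore, score, hi]

theorem IsNested.score_antitone {n : ℕ} {t : Tournament n} (ht : IsNested t) :
    Antitone (score t) := by
  intro r r' h
  have hn := r.pos
  have hi : ∀ j : Fin n, j ≤ ⟨n - 1, by omega⟩ := by
    intro j
    rw [Fin.le_def]
    simp only
    omega
  rw [← partialScore_eq_score t hi, ← partialScore_eq_score t hi]
  exact ht _ _ _ h (hi _)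

/-- Addition of a last vertex that loses exactly against `A`. -/
def Tournament.extend {n : ℕ} (A : Finset (Fin n)) (t : Tournament n) : Tournament (n + 1) :=
  ⟨fun i j => Fin.lastCases (motive := fun _ => Bool)
      (Fin.lastCases (motive := fun _ => Bool) false (fun s => decide (s ∉ A)) j)
      (fun r => Fin.lastCases (motive := fun _ => Bool) (decide (r ∈ A)) (fun s => t.1 r s) j) i,
    by
      intro i
      induction i using Fin.lastCases with
      | last => simp
      | cast r => simp [t.2.1], by
      intro i j h
      induction i using Fin.lastCases with
      | last =>
        induction j using Fin.lastCases with
        | last => exact absurd rfl h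
        | cast s => simp
      | cast r =>
        induction j using Fin.lastCases with
        | last => simp
        | cast s => simpa using t.2.2 r s fun e => h (e ▸ rfl)⟩

section extend

variable {n : ℕ} (A : Finset (Fin n)) (t : Tournament n)

@[simp] theorem extend_castSucc_castSucc (r s : Fin n) :
    (t.extend A).1 r.castSucc s.castSucc = t.1 r s := by
  simp [Tournament.extend]

@[simp] theorem extend_castSucc_last (r : Fin n) :
    (t.extend A).1 r.castSucc (Fin.last n) = decide (r ∈ A) := by
  simp [Tournament.extend]

@[simp] theorem extend_last_castSucc (s : Fin n) :
    (t.extend A).1 (Fin.last n) s.castSucc = decide (s ∉ A) := by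
  simp [Tournament.extend]

@[simp] theorem extend_last_last : (t.extend A).1 (Fin.last n) (Fin.last n) = false := by
  simp [Tournament.extend]

theorem score_extend_castSucc (r : Fin n) :
    score (t.extend A) r.castSucc = score t r + if r ∈ A then 1 else 0 := by
  simp [score, Finset.card_filter, Fin.sum_univ_castSucc, -Finset.sum_boole]

theorem score_extend_last : score (t.extend A) (Fin.last n) + A.card = n := by
  have h : score (t.extend A) (Fin.last n) = Aᶜ.card := by
    rw [score, Finset.card_filter, Fin.sum_univ_castSucc]
    simp only [extend_last_castSucc, extend_last_last]
    rw [← Finset.card_filter]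
    simp [Finset.filter_not, Finset.compl_eq_univ_sdiff]
  rw [h, Finset.card_compl, Fintype.card_fin]
  have := A.card_le_univ
  rw [Fintype.card_fin] at this
  omega

theorem partialScore_extend_castSucc (i r : Fin n) :
    partialScore (t.extend A) i.castSucc r.castSucc = partialScore t i r := by
  simp [partialScore, Finset.card_filter, Fin.sum_univ_castSucc, -Finset.sum_boole]

/-- The conditions at the old vertices are unchanged; the one at the new vertex concerns the full
score vector, which is the hypothesis. -/
theorem isNested_extend (h : Antitone (score (t.extend A))) :
    IsNested (t.extend A) ↔ IsNested t := by
  constructor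
  · intro hn i r r' h1 h2
    have := hn i.castSucc r.castSucc r'.castSucc (by simpa using h1) (by simpa using h2)
    rwa [partialScore_extend_castSucc, partialScore_extend_castSucc] at this
  · intro hn i r r' h1 h2
    induction i using Fin.lastCases with
    | last =>
      rw [partialScore_eq_score _ Fin.le_last, partialScore_eq_score _ Fin.le_last]
      exact h h1
    | cast i =>
      have e : ∀ s : Fin (n + 1), s ≤ i.castSucc → ∃ s' : Fin n, s = s'.castSucc := by
        intro s hs
        have := lt_of_le_of_lt hs (Fin.castSucc_lt_last i)
        exact ⟨s.castPred this.ne, by simp⟩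
      obtain ⟨s, rfl⟩ := e r (h1.trans h2)
      obtain ⟨s', rfl⟩ := e r' h2
      rw [partialScore_extend_castSucc, partialScore_extend_castSucc]
      exact hn i s s' (by simpa using h1) (by simpa using h2)

theorem stepWeight_extend_castSucc (K : ℕ) (i : Fin n) :
    stepWeight K (t.extend A) i.castSucc = stepWeight K t i := by
  refine Finset.prod_congr rfl fun v _ => ?_
  simp [Finset.card_filter, Fin.sum_univ_castSucc, -Finset.sum_boole, partialScore_extend_castSucc,
    (Fin.castSucc_lt_last i).not_gt]

theorem stepWeight_extend_last (K : ℕ) :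
    stepWeight K (t.extend A) (Fin.last n) = ∏ v ∈ Finset.range K,
      (Finset.univ.filter fun r : Fin n => score (t.extend A) r.castSucc = v).card.choose
        (A.filter fun r => score (t.extend A) r.castSucc = v).card := by
  refine Finset.prod_congr rfl fun v _ => ?_
  have : A = Finset.univ.filter fun r => r ∈ A := by simp
  conv_rhs => rw [this, Finset.filter_filter]
  simp [Finset.card_filter, Fin.sum_univ_castSucc, -Finset.sum_boole,
    partialScore_eq_score _ Fin.le_last, Fin.castSucc_lt_last, and_comm]

end extend

/-- Restriction of a tournament to all vertices but the last. -/
def extendEquiv (n : ℕ) : Finset (Fin n) × Tournament n ≃ Tournament (n + 1) where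
  toFun p := p.2.extend p.1
  invFun t := (Finset.univ.filter fun r => t.1 r.castSucc (Fin.last n),
    ⟨fun r s => t.1 r.castSucc s.castSucc, fun r => t.2.1 _,
      fun r s h => t.2.2 _ _ ((Fin.castSucc_injective n).ne h)⟩)
  left_inv p := by
    refine Prod.ext ?_ (Subtype.ext ?_)
    · ext r
      simp
    · funext r s
      simp
  right_inv t := by
    refine Subtype.ext (funext fun i => funext fun j => ?_)
    induction i using Fin.lastCases with
    | last =>
      induction j using Fin.lastCases with
      | last => simp [t.2.1]
      | cast s => simp [t.2.2 _ _ (Fin.castSucc_lt_last s).ne']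
    | cast r =>
      induction j using Fin.lastCases with
      | last => simp
      | cast s => simp

/-! ### Recursion on the last vertex -/

theorem score_extend_eq_iff {n : ℕ} {A : Finset (Fin n)} {t : Tournament n}
    {lam : Fin (n + 1) → ℕ} : score (t.extend A) = lam ↔
      lam (Fin.last n) + A.card = n ∧
        ∀ r : Fin n, score t r + (if r ∈ A then 1 else 0) = lam r.castSucc := by
  rw [funext_iff, Fin.forall_fin_succ']
  simp only [score_extend_castSucc]
  have := score_extend_last A t
  constructor
  · rintro ⟨h1, h2⟩
    exact ⟨by omega, h1⟩
  · rintro ⟨h1, h2⟩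
    exact ⟨h2, by omega⟩

open Classical in
-- Induction on the number of vertices. The bound `K` on the range of values is kept fixed, so that
-- step weights agree before and after the extension; unused values contribute `0.choose 0 = 1`.
theorem card_score_eq_sum_isNested {n K : ℕ} (hK : n ≤ K) {lam : Fin n → ℕ} (hlam : Antitone lam) :
    (Finset.univ.filter fun t : Tournament n => score t = lam).card =
      ∑ t : Tournament n with score t = lam ∧ IsNested t, ∏ i, stepWeight K t i := by
  induction n with
  | zero =>
    have h : ∀ t : Tournament 0, score t = lam ∧ IsNested t :=
      fun t => ⟨Subsingleton.elim _ _, fun i => i.elim0⟩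
    simp [h]
  | succ n ih =>
    set c : Fin n → ℕ := fun r => lam r.castSucc with hc
    have hcA : Antitone c := fun r s h => hlam (by simpa using h)
    by_cases hex : ∃ t : Tournament (n + 1), score t = lam
    swap
    · rw [not_exists] at hex
      simp [hex]
    have hcK : ∀ r, c r < K := by
      obtain ⟨t, rfl⟩ := hex
      intro r
      exact (score_lt t _).trans_le hK
    -- The number of ways to complete the choice `A` of the vertices beating the last one.
    -- Permutations preserving `c` act on it by relabeling the vertices.
    set f : Finset (Fin n) → ℕ := fun A => if lam (Fin.last n) + A.card = n then
      (Finset.univ.filter fun t : Tournament n =>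
        ∀ r, score t r + (if r ∈ A then 1 else 0) = c r).card else 0 with hf
    have hfσ : ∀ σ : Equiv.Perm (Fin n), c ∘ σ = c → ∀ A, f (A.map σ.toEmbedding) = f A := by
      intro σ hσ A
      have hσ' : ∀ r, c (σ r) = c r := fun r => congrFun hσ r
      simp only [hf, Finset.card_map]
      congr 1
      refine Finset.card_nbij' (Tournament.relabel σ) (Tournament.relabel σ.symm) ?_ ?_ ?_ ?_
      · intro t ht
        refine Finset.mem_filter.2 ⟨Finset.mem_univ _, fun r => ?_⟩
        have := (Finset.mem_filter.1 ht).2 (σ r)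
        rw [score_relabel, ← hσ' r, ← this]
        simp
      · intro t ht
        refine Finset.mem_filter.2 ⟨Finset.mem_univ _, fun r => ?_⟩
        have := (Finset.mem_filter.1 ht).2 (σ.symm r)
        rw [← hσ', Equiv.apply_symm_apply] at this
        rw [score_relabel, ← this]
        congr 1
        exact if_congr Finset.mem_map_equiv rfl rfl
      · intro t _
        refine Subtype.ext ?_
        simp [Tournament.relabel]
      · intro t _
        refine Subtype.ext ?_
        simp [Tournament.relabel]
    have hL : (Finset.univ.filter fun t : Tournament (n + 1) => score t = lam).card =
        ∑ A, f A := by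
      rw [Finset.card_filter, ← (extendEquiv n).sum_comp, Fintype.sum_prod_type]
      refine Finset.sum_congr rfl fun A _ => ?_
      simp only [hf, Finset.card_filter]
      by_cases h : lam (Fin.last n) + A.card = n
      · rw [if_pos h]
        refine Finset.sum_congr rfl fun t _ => if_congr ?_ rfl rfl
        exact score_extend_eq_iff.trans (and_iff_right h)
      · rw [if_neg h]
        refine Finset.sum_eq_zero fun t _ => if_neg fun h' => h (score_extend_eq_iff.1 h').1
    rw [hL, sum_finset_eq_sum_isFinalInFibers hcA hcK f hfσ, Finset.sum_filter, Finset.sum_filter,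
      ← (extendEquiv n).sum_comp, Fintype.sum_prod_type]
    refine Finset.sum_congr rfl fun A _ => ?_
    have hterm : ∀ t : Tournament n,
        (if score (t.extend A) = lam ∧ IsNested (t.extend A) then
          ∏ i, stepWeight K (t.extend A) i else 0) =
        if lam (Fin.last n) + A.card = n then
          (∏ v ∈ Finset.range K, (Finset.univ.filter fun r => c r = v).card.choose
            (A.filter fun r => c r = v).card) *
          (if (∀ r, score t r + (if r ∈ A then 1 else 0) = c r) ∧ IsNested t then
            ∏ i, stepWeight K t i else 0) else 0 := by
      intro t
      by_cases h : score (t.extend A) = lam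
      · have h' := score_extend_eq_iff.1 h
        have h3 : IsNested (t.extend A) ↔ IsNested t := isNested_extend A t (h ▸ hlam)
        rw [if_pos h'.1, if_congr (and_congr (iff_of_true h h'.2) h3) rfl rfl, mul_ite, mul_zero,
          Fin.prod_univ_castSucc, stepWeight_extend_last, h, mul_comm]
        simp only [stepWeight_extend_castSucc]
        rfl
      · rw [if_neg fun h' => h h'.1]
        split_ifs with h1 h2
        · exact absurd (score_extend_eq_iff.2 ⟨h1, h2.1⟩) h
        · simp
        · rfl
    change _ = ∑ t : Tournament n, (if score (t.extend A) = lam ∧ IsNested (t.extend A) then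
          ∏ i, stepWeight K (t.extend A) i else 0)
    simp only [hterm]
    by_cases hA : lam (Fin.last n) + A.card = n
    swap
    · simp [hf, hA]
    simp only [if_pos hA]
    rw [← Finset.mul_sum, ← mul_ite_zero]
    congr 1
    have hfA : f A = (Finset.univ.filter fun t : Tournament n =>
        ∀ r, score t r + (if r ∈ A then 1 else 0) = c r).card := by
      simp only [hf, if_pos hA]
    rw [hfA]
    split_ifs with hfin
    · by_cases h0 : ∃ t : Tournament n, ∀ r, score t r + (if r ∈ A then 1 else 0) = c r
      · obtain ⟨t0, ht0⟩ := h0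
        -- Subtracting the indicator of `A` from `c` keeps the order: inside a fiber because `A` is
        -- final there, and between fibers because the values differ by at least 1.
        have hanti : Antitone (score t0) := by
          intro r r' hr
          have h1 := ht0 r
          have h2 := ht0 r'
          have h3 := hcA hr
          by_cases h4 : c r = c r'
          · by_cases h5 : r ∈ A
            · have h6 := hfin r r' hr h4 h5
              rw [if_pos h5] at h1
              rw [if_pos h6] at h2
              omega
            · rw [if_neg h5] at h1
              omega
          · split_ifs at h1 h2 <;> omega
        have hiff : ∀ t : Tournament n,
            (∀ r, score t r + (if r ∈ A then 1 else 0) = c r) ↔ score t = score t0 := by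
          intro t
          constructor
          · intro h
            funext r
            have h1 := h r
            have h2 := ht0 r
            omega
          · intro h
            rw [h]
            exact ht0
        simp only [hiff]
        rw [ih (by omega) hanti, Finset.sum_filter]
      · rw [not_exists] at h0
        simp [h0]
    -- If `A` is not final, no nested tournament contributes: its nonincreasing scores plus the
    -- indicator of `A` would make `A` final in the fibers of `c`.
    · symm
      refine Finset.sum_eq_zero fun t _ => if_neg fun h => hfin ?_
      intro r r' hr hcr hrA
      by_contra hr'
      have h1 := h.1 r
      have h2 := h.1 r'
      have h3 := h.2.score_antitone hr
      rw [if_pos hrA] at h1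
      rw [if_neg hr'] at h2
      omega

/-! ### Spin tableaux and nested tournaments -/

/-- The number of wins of `r` against the vertices `< k`. -/
def winsBelow {n : ℕ} (t : Tournament n) (k : ℕ) (r : Fin n) : ℕ :=
  (Finset.univ.filter fun j : Fin n => (j : ℕ) < k ∧ t.1 r j).card

section winsBelow

variable {n : ℕ} (t : Tournament n)

theorem winsBelow_mono {k l : ℕ} (h : k ≤ l) (r : Fin n) : winsBelow t k r ≤ winsBelow t l r := by
  refine Finset.card_le_card fun j hj => ?_
  rw [Finset.mem_filter_univ] at hj ⊢
  exact ⟨hj.1.trans_le h, hj.2⟩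

theorem winsBelow_top (r : Fin n) : winsBelow t n r = score t r := by
  simp [winsBelow, score]

theorem winsBelow_le_score {k : ℕ} (hk : k ≤ n) (r : Fin n) : winsBelow t k r ≤ score t r := by
  rw [← winsBelow_top]
  exact winsBelow_mono t hk r

theorem partialScore_eq_winsBelow (i r : Fin n) :
    partialScore t i r = winsBelow t (i + 1) r := by
  refine congrArg Finset.card (Finset.filter_congr fun j _ => ?_)
  rw [Fin.le_def, Nat.lt_succ_iff]

theorem winsBelow_succ (i r : Fin n) :
    winsBelow t (i + 1) r = winsBelow t i r + if t.1 r i then 1 else 0 := by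
  by_cases h : t.1 r i
  · rw [if_pos h, winsBelow, winsBelow,
      ← Finset.card_insert_of_notMem (a := i) (by simp)]
    refine congrArg Finset.card (Finset.ext fun j => ?_)
    rw [Finset.mem_insert, Finset.mem_filter_univ, Finset.mem_filter_univ, Nat.lt_succ_iff_lt_or_eq,
      ← Fin.ext_iff]
    constructor
    · rintro ⟨h1 | h1, h2⟩
      · exact Or.inr ⟨h1, h2⟩
      · exact Or.inl h1
    · rintro (rfl | ⟨h1, h2⟩)
      · exact ⟨Or.inr rfl, h⟩
      · exact ⟨Or.inl h1, h2⟩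
  · rw [if_neg h, add_zero]
    refine congrArg Finset.card (Finset.filter_congr fun j _ => ?_)
    rw [Nat.lt_succ_iff_lt_or_eq, ← Fin.ext_iff]
    constructor
    · rintro ⟨h1 | rfl, h2⟩
      · exact ⟨h1, h2⟩
      · exact absurd h2 h
    · exact fun ⟨h1, h2⟩ => ⟨Or.inl h1, h2⟩

theorem winsBelow_succ_self (i : Fin n) : winsBelow t (i + 1) i = winsBelow t i i := by
  rw [winsBelow_succ, t.2.1]
  simp

/-- Each of the `i` smaller vertices either beats `i` or loses to it. In tableau terms, this is why
`i` is the entry of exactly `i` boxes: one in each row that beats `i`, the others in row `i`. -/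
theorem card_wins_add_winsBelow (i : Fin n) :
    (∑ r ∈ Finset.Iio i, if t.1 r i then 1 else 0) + winsBelow t i i = i := by
  have h : winsBelow t i i = ∑ r ∈ Finset.Iio i, if t.1 i r then 1 else 0 := by
    rw [← Finset.card_filter]
    refine congrArg Finset.card (Finset.ext fun j => ?_)
    simp
  rw [h, ← Finset.sum_add_distrib, Finset.sum_congr rfl (g := fun _ => 1), Finset.sum_const,
    Fin.card_Iio, smul_eq_mul, mul_one]
  intro r hr
  rw [t.2.2 r i (Finset.mem_Iio.1 hr).ne]
  cases t.1 i r <;> simp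

end winsBelow

variable {n : ℕ} {lam : Fin n → ℕ}

/-- The number of entries `i` in the row `r`. -/
def entryCount (τ : Box lam → Fin n) (i r : Fin n) : ℕ :=
  (Finset.univ.filter fun c : Fin (lam r) => τ ⟨r, c⟩ = i).card

/-- The number of entries `< k` in the row `r`. -/
def countBelow (τ : Box lam → Fin n) (k : ℕ) (r : Fin n) : ℕ :=
  (Finset.univ.filter fun c : Fin (lam r) => (τ ⟨r, c⟩ : ℕ) < k).card

theorem countBelow_succ (τ : Box lam → Fin n) (i r : Fin n) :
    countBelow τ (i + 1) r = countBelow τ i r + entryCount τ i r := by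
  rw [countBelow, countBelow, entryCount, ← Finset.card_union_of_disjoint]
  · refine congrArg Finset.card (Finset.ext fun c => ?_)
    rw [Finset.mem_union, Finset.mem_filter_univ, Finset.mem_filter_univ, Finset.mem_filter_univ,
      Nat.lt_succ_iff_lt_or_eq, Fin.ext_iff]
  · rw [Finset.disjoint_filter]
    intro c _ h1 h2
    rw [h2] at h1
    exact lt_irrefl _ h1

theorem card_entry_eq_sum (τ : Box lam → Fin n) (i : Fin n) :
    (Finset.univ.filter fun b : Box lam => τ b = i).card = ∑ r, entryCount τ i r := by
  simp only [entryCount, Finset.card_filter]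
  rw [Fintype.sum_sigma]

/-- The tournament in which `r < i` beats `i` if the row `r` has an entry `i`. -/
def toTournament (τ : Box lam → Fin n) : Tournament n :=
  ⟨fun r i => if r < i then decide (entryCount τ i r ≠ 0) else
      if i < r then decide (entryCount τ r i = 0) else false, fun i => by simp, fun i j h => by
    rcases lt_or_gt_of_ne h with h | h
    · simp [h, h.not_gt]
    · simp [h, h.not_gt]⟩

theorem toTournament_of_lt (τ : Box lam → Fin n) {r i : Fin n} (h : r < i) :
    (toTournament τ).1 r i = true ↔ entryCount τ i r ≠ 0 := by
  simp [toTournament, h]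

/-- The filling `τ` is the one whose entries `< k` fill the first boxes of the rows `< k`, as many
as the row wins against vertices `< k`. -/
def Codes (τ : Box lam → Fin n) (t : Tournament n) : Prop :=
  ∀ (b : Box lam) (k : ℕ), k ≤ n →
    ((τ b : ℕ) < k ↔ (b.1 : ℕ) < k ∧ (b.2 : ℕ) < winsBelow t k b.1)

/-! ### From nested tournaments to spin tableaux -/

theorem Codes.unique {τ τ' : Box lam → Fin n} {t : Tournament n} (h : Codes τ t)
    (h' : Codes τ' t) : τ = τ' := by
  funext b
  have h1 := (h b (τ b + 1) (τ b).2).1 (Nat.lt_succ_self _)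
  have h2 := (h' b (τ' b + 1) (τ' b).2).1 (Nat.lt_succ_self _)
  have h3 := (h' b (τ b + 1) (τ b).2).2 h1
  have h4 := (h b (τ' b + 1) (τ' b).2).2 h2
  exact Fin.ext (by omega)

theorem exists_codes (t : Tournament n) (ht : score t = lam) :
    ∃ τ : Box lam → Fin n, Codes τ t := by
  have key : ∀ b : Box lam, ∃ e : Fin n, ∀ k ≤ n,
      ((e : ℕ) < k ↔ (b.1 : ℕ) < k ∧ (b.2 : ℕ) < winsBelow t k b.1) := by
    intro b
    have hex : ∃ k, (b.1 : ℕ) < k ∧ (b.2 : ℕ) < winsBelow t k b.1 :=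
      ⟨n, b.1.2, by rw [winsBelow_top, ht]; exact b.2.2⟩
    classical
    have hspec := Nat.find_spec hex
    have hle : Nat.find hex ≤ n :=
      Nat.find_min' hex ⟨b.1.2, by rw [winsBelow_top, ht]; exact b.2.2⟩
    -- The condition on `k` is monotone, so it holds exactly from its least solution on; the entry
    -- is that solution minus one, since entries `< k` are being counted.
    refine ⟨⟨Nat.find hex - 1, by omega⟩, fun k hk => ⟨fun h => ?_, fun h => ?_⟩⟩
    · simp only at h
      exact ⟨by omega, hspec.2.trans_le (winsBelow_mono t (by omega) _)⟩
    · have := Nat.find_min' hex h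
      simp only
      omega
  choose τ hτ using key
  exact ⟨τ, hτ⟩

theorem Codes.countBelow_eq {τ : Box lam → Fin n} {t : Tournament n} (h : Codes τ t)
    (ht : score t = lam) {k : ℕ} (hk : k ≤ n) (r : Fin n) :
    countBelow τ k r = if (r : ℕ) < k then winsBelow t k r else 0 := by
  have hle := winsBelow_le_score t hk r
  rw [ht] at hle
  have : countBelow τ k r = (Finset.univ.filter fun c : Fin (lam r) =>
      (c : ℕ) < if (r : ℕ) < k then winsBelow t k r else 0).card := by
    refine congrArg Finset.card (Finset.filter_congr fun c _ => ?_)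
    rw [h ⟨r, c⟩ k hk]
    split_ifs with hr <;> simp [hr]
  rw [this, Fin.card_filter_val_lt]
  split_ifs <;> omega

theorem Codes.entryCount_of_lt {τ : Box lam → Fin n} {t : Tournament n} (h : Codes τ t)
    (ht : score t = lam) {r i : Fin n} (hr : r < i) :
    entryCount τ i r = if t.1 r i then 1 else 0 := by
  have h1 := countBelow_succ τ i r
  have hr' : (r : ℕ) < i := hr
  rw [h.countBelow_eq ht i.2, h.countBelow_eq ht i.2.le, if_pos hr', if_pos (by omega),
    winsBelow_succ] at h1
  omega

/-- Row `i` has no entry `< i`, so all its wins against smaller vertices are recorded at once, as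
entries `i`. -/
theorem Codes.entryCount_self {τ : Box lam → Fin n} {t : Tournament n} (h : Codes τ t)
    (ht : score t = lam) (i : Fin n) : entryCount τ i i = winsBelow t i i := by
  have h1 := countBelow_succ τ i i
  rw [h.countBelow_eq ht i.2, h.countBelow_eq ht i.2.le, if_neg (lt_irrefl _),
    if_pos (Nat.lt_succ_self _), winsBelow_succ_self] at h1
  omega

theorem sum_eq_sum_Iio_add (f : Fin n → ℕ) (i : Fin n) (hf : ∀ r, i < r → f r = 0) :
    ∑ r, f r = ∑ r ∈ Finset.Iio i, f r + f i := by
  rw [← Finset.sum_subset (Finset.subset_univ (Finset.Iic i)), ← Finset.Iio_insert,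
    Finset.sum_insert (by simp), add_comm]
  intro r _ hr
  exact hf r (by simpa using hr)

theorem Codes.toTournament_eq {τ : Box lam → Fin n} {t : Tournament n} (h : Codes τ t)
    (ht : score t = lam) : toTournament τ = t := by
  have key : ∀ r i, r < i → (toTournament τ).1 r i = t.1 r i := by
    intro r i hr
    rw [Bool.eq_iff_iff, toTournament_of_lt τ hr, h.entryCount_of_lt ht hr]
    simp
  refine Subtype.ext (funext fun r => funext fun i => ?_)
  rcases lt_trichotomy r i with hr | rfl | hr
  · exact key r i hr
  · rw [t.2.1, (toTournament τ).2.1]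
  · rw [t.2.2 r i hr.ne', (toTournament τ).2.2 r i hr.ne', key i r hr]

theorem Codes.isSpinTableau {τ : Box lam → Fin n} {t : Tournament n} (h : Codes τ t)
    (ht : score t = lam) (hn : IsNested t) : IsSpinTableau τ := by
  have hself : ∀ b, (b.1 : ℕ) < τ b + 1 ∧ (b.2 : ℕ) < winsBelow t (τ b + 1) b.1 :=
    fun b => (h b (τ b + 1) (τ b).2).1 (Nat.lt_succ_self _)
  refine ⟨fun i _ => ?_, fun b => (hself b).1, fun b c hbc hlt => ?_, fun b c hbc hlt => ?_,
    fun b c hbc hlt hb => ?_⟩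
  · rw [card_entry_eq_sum, sum_eq_sum_Iio_add _ i, h.entryCount_self ht,
      Finset.sum_congr rfl fun r hr => h.entryCount_of_lt ht (Finset.mem_Iio.1 hr),
      card_wins_add_winsBelow]
    intro r hr
    have h1 := countBelow_succ τ i r
    have hr' : (i : ℕ) < r := hr
    rw [h.countBelow_eq ht i.2, if_neg (by omega)] at h1
    omega
  · rw [Fin.le_def, ← Nat.lt_succ_iff, h b _ (τ c).2]
    have e1 : (b.1 : ℕ) = c.1 := congrArg Fin.val hbc
    have e2 : winsBelow t (τ c + 1) b.1 = winsBelow t (τ c + 1) c.1 := by rw [hbc]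
    have hc := hself c
    exact ⟨e1 ▸ hc.1, e2 ▸ hlt.trans hc.2⟩
  · rw [Fin.le_def, ← Nat.lt_succ_iff, h b _ (τ c).2]
    have hc := hself c
    -- Nestedness enters only here: the upper row has at least as many entries `≤ τ c` as the lower
    -- one, so they reach the column of `c`.
    have hle := hn (τ c) b.1 c.1 hlt.le (Fin.le_def.2 (Nat.lt_succ_iff.1 hc.1))
    rw [partialScore_eq_winsBelow, partialScore_eq_winsBelow] at hle
    have hlt' : (b.1 : ℕ) < c.1 := hlt
    exact ⟨by omega, hbc ▸ hc.2.trans_le hle⟩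
  · by_contra hcb
    -- Otherwise both columns would lie between the win counts below `τ b` and below `τ b + 1`,
    -- which differ by at most 1.
    have h1 := (h c (τ b + 1) (τ b).2).1 (Nat.lt_succ_iff.2 (Fin.le_def.1 (not_lt.1 hcb)))
    have h2 := mt (h b (τ b) (τ b).2.le).2 (lt_irrefl _)
    have h3 := winsBelow_succ t (τ b) b.1
    have e : winsBelow t (τ b + 1) b.1 = winsBelow t (τ b + 1) c.1 := by rw [hbc]
    have h4 : ¬ (b.2 : ℕ) < winsBelow t (τ b) b.1 := fun h => h2 ⟨by omega, h⟩
    split_ifs at h3 <;> omega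

/-! ### From spin tableaux to nested tournaments -/

namespace IsSpinTableau

variable {τ : Box lam → Fin n}

theorem row_monotone (h : IsSpinTableau τ) (r : Fin n) :
    Monotone fun c : Fin (lam r) => τ ⟨r, c⟩ := by
  intro c d hcd
  rcases hcd.eq_or_lt with rfl | hlt
  · exact le_rfl
  · exact h.row_mono ⟨r, c⟩ ⟨r, d⟩ rfl hlt

theorem lt_countBelow_iff (h : IsSpinTableau τ) (k : ℕ) (r : Fin n) (c : Fin (lam r)) :
    (c : ℕ) < countBelow τ k r ↔ (τ ⟨r, c⟩ : ℕ) < k :=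
  Tuple.lt_card_lt_iff_apply_lt_of_monotone (f := fun c : Fin (lam r) => (τ ⟨r, c⟩ : ℕ)) (a := k)
    fun _ _ hcd => h.row_monotone r hcd

/-- The entry 0 is not constrained by the content condition, but the entries `1, …, n-1` already
fill all n(n-1)/2 boxes. -/
theorem content_of_sum_eq (h : IsSpinTableau τ) (hlam : ∑ i, lam i = n.choose 2) (i : Fin n) :
    (Finset.univ.filter fun b : Box lam => τ b = i).card = i := by
  by_cases hi : 1 ≤ (i : ℕ)
  · exact h.content i hi
  have h1 : ∑ j : Fin n, (Finset.univ.filter fun b : Box lam => τ b = j).card =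
      ∑ j : Fin n, (j : ℕ) := by
    rw [← Finset.card_eq_sum_card_fiberwise (s := Finset.univ) (fun _ _ => Finset.mem_univ _),
      Finset.card_univ, Fintype.card_sigma, Fin.sum_univ_eq_sum_range fun j => j,
      Finset.sum_range_id, ← Nat.choose_two_right, ← hlam]
    simp
  rw [← Finset.add_sum_erase _ _ (Finset.mem_univ i),
    ← Finset.add_sum_erase _ _ (Finset.mem_univ i)] at h1
  have h2 : ∑ j ∈ Finset.univ.erase i, (Finset.univ.filter fun b : Box lam => τ b = j).card =
      ∑ j ∈ Finset.univ.erase i, (j : ℕ) := by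
    refine Finset.sum_congr rfl fun j hj => h.content j ?_
    have : j ≠ i := Finset.ne_of_mem_erase hj
    rw [Ne, Fin.ext_iff] at this
    omega
  omega

theorem entryCount_eq_zero (h : IsSpinTableau τ) {i r : Fin n} (hi : i < r) :
    entryCount τ i r = 0 := by
  refine Finset.card_eq_zero.2 (Finset.filter_eq_empty_iff.2 fun c _ hc => ?_)
  have := h.location ⟨r, c⟩
  rw [hc] at this
  have hi' : (i : ℕ) < r := hi
  simp only at this
  omega

theorem entryCount_of_lt (h : IsSpinTableau τ) {i r : Fin n} (hr : r < i) :
    entryCount τ i r = if (toTournament τ).1 r i then 1 else 0 := by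
  rw [if_congr (toTournament_of_lt τ hr) rfl rfl]
  have : entryCount τ i r ≤ 1 := by
    refine Finset.card_le_one.2 fun c hc d hd => ?_
    rw [Finset.mem_filter_univ] at hc hd
    have hr' : (r : ℕ) < i := hr
    by_contra hne
    rcases lt_or_gt_of_ne hne with hlt | hlt
    · exact (h.row_strict ⟨r, c⟩ ⟨r, d⟩ rfl hlt (by rw [hc]; exact hr')).ne (hc.trans hd.symm)
    · exact (h.row_strict ⟨r, d⟩ ⟨r, c⟩ rfl hlt (by rw [hd]; exact hr')).ne (hd.trans hc.symm)
  split_ifs <;> omega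

/-- The content condition determines what is left for row `i` once the rows above have taken one box
for each win against `i`. -/
theorem entryCount_self (h : IsSpinTableau τ) (hlam : ∑ i, lam i = n.choose 2) (i : Fin n) :
    entryCount τ i i = winsBelow (toTournament τ) i i := by
  have h1 := h.content_of_sum_eq hlam i
  rw [card_entry_eq_sum, sum_eq_sum_Iio_add _ i fun r hr => h.entryCount_eq_zero hr,
    Finset.sum_congr rfl fun r hr => h.entryCount_of_lt (Finset.mem_Iio.1 hr)] at h1
  have h2 := card_wins_add_winsBelow (toTournament τ) i
  omega

theorem countBelow_eq (h : IsSpinTableau τ) (hlam : ∑ i, lam i = n.choose 2) {k : ℕ} (hk : k ≤ n)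
    (r : Fin n) :
    countBelow τ k r = if (r : ℕ) < k then winsBelow (toTournament τ) k r else 0 := by
  induction k with
  | zero => simp [countBelow]
  | succ k ih =>
    have h1 := countBelow_succ τ ⟨k, hk⟩ r
    have h2 := winsBelow_succ (toTournament τ) ⟨k, hk⟩ r
    simp only at h1 h2
    rw [h1, ih (by omega)]
    rcases lt_trichotomy (r : ℕ) k with hr | hr | hr
    · rw [if_pos hr, if_pos (by omega), h2, h.entryCount_of_lt (Fin.lt_def.2 hr)]
    · have hr' : r = ⟨k, hk⟩ := Fin.ext hr
      have h3 := winsBelow_succ_self (toTournament τ) ⟨k, hk⟩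
      simp only at h3
      rw [if_neg (by omega), if_pos (by omega), hr', h3, h.entryCount_self hlam, zero_add]
    · rw [if_neg (by omega), if_neg (by omega), h.entryCount_eq_zero (Fin.lt_def.2 hr)]

theorem codes (h : IsSpinTableau τ) (hlam : ∑ i, lam i = n.choose 2) :
    Codes τ (toTournament τ) := by
  rintro ⟨r, c⟩ k hk
  rw [← h.lt_countBelow_iff, h.countBelow_eq hlam hk]
  split_ifs with hr <;> simp [hr]

theorem score_toTournament (h : IsSpinTableau τ) (hlam : ∑ i, lam i = n.choose 2) :
    score (toTournament τ) = lam := by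
  funext r
  have h1 := h.countBelow_eq hlam le_rfl r
  rw [if_pos r.2, winsBelow_top] at h1
  rw [← h1]
  simp [countBelow]

theorem isNested (h : IsSpinTableau τ) (hlam : ∑ i, lam i = n.choose 2) (hanti : Antitone lam) :
    IsNested (toTournament τ) := by
  intro i r r' hr hi
  rw [partialScore_eq_winsBelow, partialScore_eq_winsBelow]
  rcases hr.eq_or_lt with rfl | hr
  · exact le_rfl
  by_contra hlt
  rw [not_le] at hlt
  -- `q` is the first column of row `r` beyond its entries `≤ i`. Row `r'` still has an entry `≤ i`
  -- there, although the box above it, which exists because `lam` is nonincreasing, has an entry `>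
  -- i`.
  set q := winsBelow (toTournament τ) (i + 1) r
  have h1 := (hlt.trans_le (winsBelow_le_score _ i.2 r'))
  rw [h.score_toTournament hlam] at h1
  have h2 := h1.trans_le (hanti hr.le)
  have hcodes := h.codes hlam
  have hr' : (r : ℕ) < r' := hr
  have hi' : (r' : ℕ) ≤ i := hi
  have h3 := (hcodes ⟨r', ⟨q, h1⟩⟩ (i + 1) i.2).2 ⟨by simp only; omega, hlt⟩
  have h4 := h.col_mono ⟨r, ⟨q, h2⟩⟩ ⟨r', ⟨q, h1⟩⟩ rfl hr
  have h5 := (hcodes ⟨r, ⟨q, h2⟩⟩ (i + 1) i.2).1 (lt_of_le_of_lt h4 h3)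
  exact lt_irrefl _ h5.2

end IsSpinTableau

/-! ### Weights -/

theorem card_column_eq (j : ℕ) (Q : Box lam → Prop) (R : Fin n → Prop) [DecidablePred Q]
    [DecidablePred R] (h : ∀ b : Box lam, (b.2 : ℕ) = j → (Q b ↔ R b.1))
    (hR : ∀ r, R r → j < lam r) :
    (Finset.univ.filter fun b : Box lam => (b.2 : ℕ) = j ∧ Q b).card =
      (Finset.univ.filter R).card := by
  refine Finset.card_bij (fun b _ => b.1) ?_ ?_ ?_
  · intro b hb
    rw [Finset.mem_filter_univ] at hb ⊢
    exact (h b hb.1).1 hb.2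
  · rintro ⟨r, c⟩ hb ⟨r', c'⟩ hb' hrr
    rw [Finset.mem_filter_univ] at hb hb'
    simp only at hrr
    subst hrr
    have : c = c' := Fin.ext (hb.1.trans hb'.1.symm)
    rw [this]
  · intro r hr
    rw [Finset.mem_filter_univ] at hr
    exact ⟨⟨r, ⟨j, hR r hr⟩⟩, by
      rw [Finset.mem_filter_univ]
      exact ⟨rfl, (h _ rfl).2 hr⟩, rfl⟩

/-- In a row `r < i` an entry `i` is unique and last among the entries `≤ i`. It lies in column `j`,
numbered from 0, exactly when those entries number `j + 1`. -/
theorem Codes.lowerIndex_eq {τ : Box lam → Fin n} {t : Tournament n} (h : Codes τ t)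
    (ht : score t = lam) (i : Fin n) (j : ℕ) :
    lowerIndex τ i j = (Finset.univ.filter fun r : Fin n =>
      r < i ∧ partialScore t i r = j + 1 ∧ t.1 r i).card := by
  refine card_column_eq j _ _ (fun b hb => ?_) fun r hr => ?_
  · rw [partialScore_eq_winsBelow, Fin.lt_def]
    have h1 := h b (i + 1) i.2
    have h2 := h b i i.2.le
    have h3 := winsBelow_succ t i b.1
    rw [Fin.ext_iff]
    constructor
    · rintro ⟨h4, h5⟩
      rw [h4] at h1 h2
      have h6 := h1.1 (Nat.lt_succ_self _)
      have h7 := mt h2.2 (lt_irrefl _)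
      by_cases h8 : t.1 b.1 i
      · rw [if_pos h8] at h3
        refine ⟨h5, ?_, h8⟩
        omega
      · rw [if_neg h8] at h3
        exact absurd ⟨h5, by omega⟩ h7
    · rintro ⟨h4, h5, h6⟩
      rw [if_pos h6] at h3
      have h7 := h1.2 ⟨by omega, by omega⟩
      have h8 := mt h2.1 (by omega)
      exact ⟨by omega, h4⟩
  · have h1 := winsBelow_le_score t (k := i + 1) i.2 r
    rw [ht] at h1
    have h2 := hr.2.1
    rw [partialScore_eq_winsBelow] at h2
    omega

/-- The last entry `≤ i` of a row `r < i` is either `i` itself, counted by `lowerIndex`, or smaller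
than `i` with no right neighbor or one `> i`. Both cases together are all rows whose entries `≤ i`
end in column `j`. -/
theorem Codes.upperIndex_eq {τ : Box lam → Fin n} {t : Tournament n} (h : Codes τ t)
    (ht : score t = lam) (i : Fin n) (j : ℕ) :
    upperIndex τ i j = (Finset.univ.filter fun r : Fin n =>
      r < i ∧ partialScore t i r = j + 1).card := by
  have hle : ∀ r, winsBelow t (i + 1) r ≤ lam r := by
    intro r
    rw [← ht]
    exact winsBelow_le_score t i.2 r
  rw [upperIndex, h.lowerIndex_eq ht, card_column_eq j (fun b => τ b < i ∧
      ∀ c : Box lam, c.1 = b.1 → (c.2 : ℕ) = (b.2 : ℕ) + 1 → i < τ c)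
    (fun r => r < i ∧ partialScore t i r = j + 1 ∧ ¬ t.1 r i)]
  · rw [← Finset.card_filter_add_card_filter_not (s := Finset.univ.filter fun r : Fin n =>
      r < i ∧ partialScore t i r = j + 1) (fun r => t.1 r i = true), Finset.filter_filter,
      Finset.filter_filter]
    simp only [and_assoc]
  · intro b hb
    rw [partialScore_eq_winsBelow, Fin.lt_def, Fin.lt_def, h b i i.2.le]
    have h3 := winsBelow_succ t i b.1
    constructor
    · rintro ⟨⟨h4, h5⟩, h6⟩
      have h7 : winsBelow t (i + 1) b.1 ≤ j + 1 := by
        by_contra hlt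
        rw [not_le] at hlt
        have h8 := h6 ⟨b.1, ⟨j + 1, hlt.trans_le (hle _)⟩⟩ rfl (by simp only; omega)
        have h9 := (h ⟨b.1, ⟨j + 1, hlt.trans_le (hle _)⟩⟩ (i + 1) i.2).2
          ⟨by simp only; omega, hlt⟩
        rw [Fin.lt_def] at h8
        omega
      by_cases h8 : t.1 b.1 i
      · rw [if_pos h8] at h3
        omega
      · rw [if_neg h8] at h3
        exact ⟨h4, by omega, h8⟩
    · rintro ⟨h4, h5, h6⟩
      rw [if_neg h6] at h3
      refine ⟨⟨h4, by omega⟩, fun c hc1 hc2 => ?_⟩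
      rw [Fin.lt_def]
      by_contra hlt
      have h7 := (h c (i + 1) i.2).1 (by omega)
      have e : winsBelow t (i + 1) c.1 = winsBelow t (i + 1) b.1 := by rw [hc1]
      omega
  · intro r hr
    have h2 := hr.2.1
    rw [partialScore_eq_winsBelow] at h2
    have := hle r
    omega

open Classical in
theorem tableauWeight_eq_prod (τ : Box lam → Fin n) (K : ℕ) (hK : ∀ r, lam r ≤ K) :
    tableauWeight τ = ∏ i : Fin n, ∏ j ∈ Finset.range K,
      (upperIndex τ i j).choose (lowerIndex τ i j) := by
  rw [← Finset.prod_product', tableauWeight]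
  have hinj : Set.InjOn (fun b : Box lam => (τ b, (b.2 : ℕ)))
      (Finset.univ.filter fun b : Box lam => IsLastInColumn τ b : Finset (Box lam)) := by
    rintro ⟨r, c⟩ hb ⟨r', c'⟩ hb' heq
    have hb := (Finset.mem_filter.1 hb).2
    have hb' := (Finset.mem_filter.1 hb').2
    obtain ⟨h1, h2⟩ := Prod.ext_iff.1 heq
    have h3 : r = r' := le_antisymm (hb' _ h2 h1) (hb _ h2.symm h1.symm)
    subst h3
    have : c = c' := Fin.ext h2
    rw [this]
  rw [← Finset.prod_image (f := fun p : Fin n × ℕ =>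
    (upperIndex τ p.1 p.2).choose (lowerIndex τ p.1 p.2)) hinj]
  refine Finset.prod_subset ?_ ?_
  · intro p hp
    obtain ⟨b, _, rfl⟩ := Finset.mem_image.1 hp
    exact Finset.mem_product.2 ⟨Finset.mem_univ _,
      Finset.mem_range.2 (b.2.2.trans_le (hK b.1))⟩
  -- A pair without a marked box has lower index 0 and contributes 1: any box with entry `i` in
  -- column `j` would give a lowest one, which is marked.
  · rintro ⟨i, j⟩ _ hp
    suffices lowerIndex τ i j = 0 by simp [this]
    refine Finset.card_eq_zero.2 (Finset.filter_eq_empty_iff.2 fun b _ hb => hp ?_)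
    obtain ⟨b', hb', hmax⟩ := Finset.exists_max_image
      (Finset.univ.filter fun b : Box lam => (b.2 : ℕ) = j ∧ τ b = i) (fun b => b.1)
      ⟨b, by simp [hb.1, hb.2.1]⟩
    rw [Finset.mem_filter_univ] at hb'
    refine Finset.mem_image.2 ⟨b', Finset.mem_filter.2 ⟨Finset.mem_univ _, fun c hc1 hc2 => ?_⟩, ?_⟩
    · exact hmax c (by rw [Finset.mem_filter_univ]; exact ⟨hc1.trans hb'.1, hc2.trans hb'.2⟩)
    · rw [hb'.1, hb'.2]

theorem Codes.tableauWeight_eq {τ : Box lam → Fin n} {t : Tournament n} (h : Codes τ t)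
    (ht : score t = lam) : tableauWeight τ = ∏ i, stepWeight (n + 1) t i := by
  rw [tableauWeight_eq_prod τ n fun r => by rw [← ht]; exact (score_lt t r).le]
  refine Finset.prod_congr rfl fun i _ => ?_
  rw [stepWeight, Finset.prod_range_succ']
  -- Column `j` corresponds to the value `j + 1`, so the value 0 is left over. Its factor is 1,
  -- since a row that beats `i` has at least one win.
  have h0 : (Finset.univ.filter fun r : Fin n => r < i ∧ partialScore t i r = 0 ∧ t.1 r i) = ∅ := by
    refine Finset.filter_eq_empty_iff.2 fun r _ hr => ?_
    have h1 := hr.2.1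
    rw [partialScore_eq_winsBelow, winsBelow_succ, if_pos hr.2.2] at h1
    omega
  rw [h0, Finset.card_empty, Nat.choose_zero_right, mul_one]
  refine Finset.prod_congr rfl fun j _ => ?_
  rw [h.upperIndex_eq ht, h.lowerIndex_eq ht]

open Classical in
theorem sum_tableauWeight_eq (hanti : Antitone lam) (hlam : ∑ i, lam i = n.choose 2) :
    ∑ τ ∈ spinTableaux lam, tableauWeight τ =
      ∑ t : Tournament n with score t = lam ∧ IsNested t, ∏ i, stepWeight (n + 1) t i := by
  have hmem : ∀ τ : Box lam → Fin n, τ ∈ spinTableaux lam ↔ IsSpinTableau τ := by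
    intro τ
    simp [spinTableaux]
  refine Finset.sum_nbij toTournament ?_ ?_ ?_ ?_
  · intro τ hτ
    rw [hmem] at hτ
    exact Finset.mem_filter.2 ⟨Finset.mem_univ _, hτ.score_toTournament hlam,
      hτ.isNested hlam hanti⟩
  · intro τ hτ τ' hτ' heq
    rw [Finset.mem_coe, hmem] at hτ hτ'
    have h1 := hτ'.codes hlam
    rw [← heq] at h1
    exact (hτ.codes hlam).unique h1
  · intro t ht
    obtain ⟨h1, h2⟩ := (Finset.mem_filter.1 ht).2
    obtain ⟨τ, hτ⟩ := exists_codes t h1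
    exact ⟨τ, (hmem τ).2 (hτ.isSpinTableau h1 h2), hτ.toTournament_eq h1⟩
  · intro τ hτ
    rw [hmem] at hτ
    exact (hτ.codes hlam).tableauWeight_eq (hτ.score_toTournament hlam)

end SpinModule

theorem theoremC (n : ℕ) (hn : 1 ≤ n) (lam : Fin n → ℕ)
    (hlam : SpinModule.IsSpinPartition n lam) :
    SpinModule.spinMult n (SpinModule.muWeight lam) =
      ∑ τ ∈ SpinModule.spinTableaux lam, SpinModule.tableauWeight τ := by
  rw [SpinModule.spinMult_muWeight hn hlam.sum_eq,
    SpinModule.sum_tableauWeight_eq hlam.antitone hlam.sum_eq,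
    SpinModule.card_score_eq_sum_isNested n.le_succ hlam.antitone]
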